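/- Conventions. Let $\mathcal F$ be a finite set of function symbols with an arity $\mathrm{ar}(f)\in\mathbb N_0$ for every $f\in\mathcal F$, and let $\mathcal V$ be a finite set of variables, disjoint from $\mathcal F$. A term rewriting system (TRS) $R=(\mathcal F,\mathcal V,\mathcal R)$ is a finite set $\mathcal R$ of rules $\ell\to r$, where $\ell,r$ are terms over $\mathcal F$ and $\mathcal V$, $\ell$ is not a variable, and every variable of $r$ occurs in $\ell$. (Symbols that occur in no rule are allowed in $\mathcal F$ and $\mathcal V$; systems with minimal symbol sets are a special case.) A term isomorphism $\phi$ from $(\mathcal F,\mathcal V)$ to $(\mathcal F',\mathcal V')$ is a pair of bijections $\phi_{\mathcal F}:\mathcal F\to\mathcal F'$, preserving arities, and $\phi_{\mathcal V}:\mathcal V\to\mathcal V'$, extended to terms by renaming the symbols. It is $\mathcal F$-invariant if $\mathcal F=\mathcal F'$ and $\phi_{\mathcal F}=\mathrm{id}$, and $\mathcal V$-invariant if $\mathcal V=\mathcal V'$ and $\phi_{\mathcal V}=\mathrm{id}$. A TRS $R$ is in normal form (respectively $\mathcal V$-normal form, $\mathcal F$-normal form) if there are no two distinct rules $\ell\to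 r$ and $\ell'\to r'$ of $R$ with $\phi(\ell)=\ell'$ and $\phi(r)=r'$ for some term isomorphism (respectively some $\mathcal F$-invariant, some $\mathcal V$-invariant term isomorphism) $\phi$ from $(\mathcal F,\mathcal V)$ to itself. Let $R=(\mathcal F,\mathcal V,\mathcal R)$ with $\mathcal R=\{\ell_1\to r_1,\dots,\ell_n\to r_n\}$ (distinct rules) and $R'=(\mathcal F',\mathcal V',\mathcal R')$ be TRSs. They are locally isomorphic, $R\cong_{\mathbf{LE}}R'$, if both are in normal form and there are term isomorphisms $\phi_1,\dots,\phi_n$ from $(\mathcal F,\mathcal V)$ to $(\mathcal F',\mathcal V')$ with $$\{\phi_1(\ell_1)\to\phi_1(r_1),\dots,\phi_n(\ell_n)\to\phi_n(r_n)\}=\mathcal R'.$$ They are $\mathcal V$-locally isomorphic, $R\cong_{\mathbf{LVE}}R'$, if both are in $\mathcal V$-normal form and there are such $\phi_1,\dots,\phi_n$ that are all $\mathcal F$-invariant. They are $\mathcal F$-locally isomorphic, $R\cong_{\mathbf{LFE}}R'$, if both are in $\mathcal F$-normal form and there are such $\phi_1,\dots,\phi_n$ that are all $\mathcal V$-invariant.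 Theorem (Local TRS Isomorphisms are in $\mathbf P$). Each of the three relations $\cong_{\mathbf{LE}}$, $\cong_{\mathbf{LVE}}$ and $\cong_{\mathbf{LFE}}$ can be decided in polynomial time: for each of them there are a Turing machine and a polynomial $p$ such that the machine, given any pair $(R,R')$ of TRSs, halts after at most $p(N)$ steps with the correct answer to the question whether $R$ and $R'$ are related. Here a TRS is given as a word over a fixed finite alphabet that lists, in any order and without repetitions, its function symbols with their arities, its variables, and its rules (symbol names and arities in binary, terms in prefix notation), and $N$ is the length of the input word. -/

import Mathlib

namespace TermRewriting

/-! ### Terms, term isomorphisms, term rewriting systems -/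

/-- The symbols of a term set: a finite set of function symbols, each with a fixed arity, and a
finite set of variables. Symbols are named by natural numbers; function symbols and variables are
kept apart by their types, hence are always disjoint. -/
structure Signature where
  funs : Finset ℕ
  arity : funs → ℕ
  vars : Finset ℕ

/-- The terms over the function symbols and variables of `S`. -/
inductive Term (S : Signature) : Type
  | var (x : S.vars) : Term S
  | app (f : S.funs) (ts : Fin (S.arity f) → Term S) : Term S

/-- The set of variables that occur in a term. -/
def Term.varSet {S : Signature} : Term S → Set S.vars
  | .var x => {x}
  | .app _ ts => ⋃ i, (ts i).varSet

/-- A term isomorphism: a bijection of the function symbols that preserves arities, together with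
a bijection of the variables. -/
structure TermIso (S T : Signature) where
  onFun : S.funs ≃ T.funs
  onVar : S.vars ≃ T.vars
  arity_eq : ∀ f, S.arity f = T.arity (onFun f)

namespace TermIso

variable {S T : Signature}

/-- The canonical extension of a term isomorphism to all terms. -/
def mapTerm (φ : TermIso S T) : Term S → Term T
  | .var x => .var (φ.onVar x)
  | .app f ts => .app (φ.onFun f) (fun i => φ.mapTerm (ts (Fin.cast (φ.arity_eq f).symm i)))

/-- Both signatures have the same function symbols, and `φ` is the identity on them. -/
def FunInvariant (φ : TermIso S T) : Prop :=
  S.funs = T.funs ∧ ∀ f : S.funs, (φ.onFun f : ℕ) = (f : ℕ)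

/-- Both signatures have the same variables, and `φ` is the identity on them. -/
def VarInvariant (φ : TermIso S T) : Prop :=
  S.vars = T.vars ∧ ∀ x : S.vars, (φ.onVar x : ℕ) = (x : ℕ)

end TermIso

/-- A pair of terms, read as the rewriting rule `lhs → rhs`. -/
structure Rule (S : Signature) where
  lhs : Term S
  rhs : Term S

/-- Renaming both sides of a rule. -/
def TermIso.mapRule {S T : Signature} (φ : TermIso S T) (ρ : Rule S) : Rule T :=
  ⟨φ.mapTerm ρ.lhs, φ.mapTerm ρ.rhs⟩

/-- A term rewriting system: a finite set of rules whose left-hand side is not a variable and whose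
right-hand side has no variable that is missing on the left. The symbol sets may contain symbols
that occur in no rule. -/
structure TRS where
  sig : Signature
  rules : Finset (Rule sig)
  lhs_ne_var : ∀ ρ ∈ rules, ∀ x, ρ.lhs ≠ Term.var x
  rhs_vars : ∀ ρ ∈ rules, ρ.rhs.varSet ⊆ ρ.lhs.varSet

/-! ### Normal forms and local isomorphisms -/

/-- No two distinct rules are equal up to a renaming of function symbols and variables. -/
def TRS.NormalForm (R : TRS) : Prop :=
  ∀ ρ ∈ R.rules, ∀ τ ∈ R.rules, ρ ≠ τ → ¬ ∃ φ : TermIso R.sig R.sig, φ.mapRule ρ = τ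

/-- No two distinct rules are equal up to a renaming of variables. -/
def TRS.VNormalForm (R : TRS) : Prop :=
  ∀ ρ ∈ R.rules, ∀ τ ∈ R.rules, ρ ≠ τ →
    ¬ ∃ φ : TermIso R.sig R.sig, φ.FunInvariant ∧ φ.mapRule ρ = τ

/-- No two distinct rules are equal up to a renaming of function symbols. -/
def TRS.FNormalForm (R : TRS) : Prop :=
  ∀ ρ ∈ R.rules, ∀ τ ∈ R.rules, ρ ≠ τ →
    ¬ ∃ φ : TermIso R.sig R.sig, φ.VarInvariant ∧ φ.mapRule ρ = τ

/-- The set of rules obtained by applying to each rule of `R` its own term isomorphism. -/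
def localImage (R R' : TRS) (φ : R.rules → TermIso R.sig R'.sig) : Set (Rule R'.sig) :=
  Set.range fun ρ : R.rules => (φ ρ).mapRule ρ.1

/-- Local isomorphism: function symbols and variables are renamed separately in each rule. -/
def LocallyIso (R R' : TRS) : Prop :=
  R.NormalForm ∧ R'.NormalForm ∧
    ∃ φ : R.rules → TermIso R.sig R'.sig, localImage R R' φ = (R'.rules : Set (Rule R'.sig))

/-- `V`-local isomorphism: variables are renamed separately in each rule, and function symbols
are not renamed. -/
def VLocallyIso (R R' : TRS) : Prop :=
  R.VNormalForm ∧ R'.VNormalForm ∧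
    ∃ φ : R.rules → TermIso R.sig R'.sig, (∀ ρ, (φ ρ).FunInvariant) ∧
      localImage R R' φ = (R'.rules : Set (Rule R'.sig))

/-- `F`-local isomorphism: function symbols are renamed separately in each rule, and variables
are not renamed. -/
def FLocallyIso (R R' : TRS) : Prop :=
  R.FNormalForm ∧ R'.FNormalForm ∧
    ∃ φ : R.rules → TermIso R.sig R'.sig, (∀ ρ, (φ ρ).VarInvariant) ∧
      localImage R R' φ = (R'.rules : Set (Rule R'.sig))

/-! ### Term rewriting systems as inputs of a machine -/

/-- A term rewriting system together with an arbitrary listing, without repetitions, of its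
function symbols, of its variables and of its rules. -/
structure ListedTRS extends TRS where
  funList : List sig.funs
  funList_nodup : funList.Nodup
  mem_funList : ∀ f, f ∈ funList
  varList : List sig.vars
  varList_nodup : varList.Nodup
  mem_varList : ∀ x, x ∈ varList
  ruleList : List (Rule sig)
  ruleList_nodup : ruleList.Nodup
  mem_ruleList : ∀ ρ, ρ ∈ ruleList ↔ ρ ∈ rules

/-- The finite input alphabet: binary digits, and markers in front of a system, a rule, the
right-hand side of a rule, the name of a function symbol, its arity, and the name of a variable. -/
inductive Letter : Type
  | bit (b : Bool)
  | system
  | rule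
  | arrow
  | function
  | arity
  | variable
  deriving DecidableEq, Fintype

/-- A natural number in binary. -/
def encodeNumber (n : ℕ) : List Letter :=
  (Computability.encodeNat n).map Letter.bit

/-- A variable: a marker and its name. -/
def encodeVar {S : Signature} (x : S.vars) : List Letter :=
  Letter.variable :: encodeNumber x

/-- A function symbol: its name and its arity, each after a marker. -/
def encodeFun {S : Signature} (f : S.funs) : List Letter :=
  Letter.function :: encodeNumber f ++ Letter.arity :: encodeNumber (S.arity f)

/-- A term in prefix notation. -/
def encodeTerm {S : Signature} : Term S → List Letter
  | .var x => encodeVar x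
  | .app f ts => encodeFun f ++ (List.ofFn fun i => encodeTerm (ts i)).flatten

/-- The two sides of a rule, each after a marker. -/
def encodeRule {S : Signature} (ρ : Rule S) : List Letter :=
  Letter.rule :: encodeTerm ρ.lhs ++ Letter.arrow :: encodeTerm ρ.rhs

/-- The listed function symbols, then the listed variables, then the listed rules. -/
def encodeTRS (R : ListedTRS) : List Letter :=
  Letter.system ::
    R.funList.flatMap encodeFun ++ R.varList.flatMap encodeVar ++ R.ruleList.flatMap encodeRule

/-- The code of a pair of systems: their codes, one after the other. -/
def encodePair (p : ListedTRS × ListedTRS) : List Letter :=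
  encodeTRS p.1 ++ encodeTRS p.2

/-- The property `P` of inputs can be decided in polynomial time: some Turing machine (with several
stacks, in the sense of Mathlib), started on the word `enc a`, halts with the truth value of `P a`
as its output, after a number of steps that is bounded by a polynomial in the length of `enc a`. -/
def DecidableInPolyTime {α Γ : Type} (enc : α → List Γ) (P : α → Prop) : Prop :=
  ∃ f : α → Bool, (∀ a, f a = true ↔ P a) ∧
    Nonempty (Turing.TM2ComputableInPolyTime enc Computability.encodeBool f)

end TermRewriting

/-! Two flags say whether the names of function symbols and of variables must be kept; the three
relations are three settings of these flags. Write rules in prefix notation as sequences of tokens,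
where function tokens carry their arity. A term isomorphism with the required invariance takes ρ to
τ if and only if (1) the two signatures have the same multiset of symbols after the irrelevant names
are forgotten, and (2) the two sequences have the same length, agree entry by entry after
forgetting, and have equal entries at the same pairs of positions. Necessity is clear. Conversely,
(2) says that standing at the same position is a partial bijection of symbols that preserves colours
(forgotten tokens), and (1) makes corresponding colour classes equally large, so the partial
bijection extends (`exists_equiv_extending`). This is `exists_termIso_iff`; no search over
isomorphisms remains.

Being isomorphic is symmetric and transitive for rules, also across systems. Hence two systems are
locally isomorphic if and only if no two rules of one system are isomorphic and every rule of either
system has an isomorphic partner in the other one: by the normal form of the second system partners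
in it are unique, so isomorphisms chosen arbitrarily for the rules of the first system reach all of
its rules (`locallyIsoKeeping_iff`).

This criterion is one fixed formula about positions of the input word, built from letters, order,
equality of the binary words after two positions, Boolean connectives, and the quantifier "as many x
satisfy P as satisfy Q". That quantifier yields the usual ones and compares distances and multisets.
A fixed formula is decided in polynomial time by nested loops (`Dec`): each variable is a word split
over two stacks, and a quantifier evaluates its body at all positions and compares two unary
counters. The loops are structured programs, which a machine with several stacks simulates step by
step (`Runs.reaches`).

The formula is not written in terms of letters. `Encoded.isLogic` carries all closure properties
from words to lists of tokens, and from these to lists of rules, by relativising quantifiers to the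
symbols that start a segment. Only codes of pairs of systems occur as inputs, so the formula has to
be correct for these alone. -/

/-! ### Structured programs on stacks -/

namespace StackProgram

open Turing Function StateTransition

/-- Structured programs that manipulate stacks over the alphabet `A` that are indexed by `K`.
The tests of `ite` and `loop` look at the top symbols of two stacks. -/
inductive Cmd (K A : Type) : Type
  | skip
  | push (k : K) (a : A)
  | pop (k : K)
  | copy (k k' : K)
  | seq (c d : Cmd K A)
  | ite (k k' : K) (p : Option A → Option A → Bool) (c d : Cmd K A)
  | loop (k k' : K) (p : Option A → Option A → Bool) (c : Cmd K A)

variable {K A : Type} [DecidableEq K]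

/-- `Runs c S S' t`: the program `c` transforms the stacks `S` into `S'` in `t` steps. -/
inductive Runs : Cmd K A → (K → List A) → (K → List A) → ℕ → Prop
  | skip (S) : Runs .skip S S 1
  | push (S k a) : Runs (.push k a) S (update S k (a :: S k)) 1
  | pop (S k) : Runs (.pop k) S (update S k (S k).tail) 1
  | copy (S k k') : Runs (.copy k k') S (update S k' ((S k).head?.toList ++ S k')) 1
  | seq {c d S S' S'' t t'} : Runs c S S' t → Runs d S' S'' t' → Runs (.seq c d) S S'' (t + t')
  | ite_true {k k' p c d S S' t} : p (S k).head? (S k').head? = true → Runs c S S' t →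
      Runs (.ite k k' p c d) S S' (t + 1)
  | ite_false {k k' p c d S S' t} : p (S k).head? (S k').head? = false → Runs d S S' t →
      Runs (.ite k k' p c d) S S' (t + 1)
  | loop_done {k k' p c S} : p (S k).head? (S k').head? = false → Runs (.loop k k' p c) S S 1
  | loop_step {k k' p c S S' S'' t t'} : p (S k).head? (S k').head? = true → Runs c S S' t →
      Runs (.loop k k' p c) S' S'' t' → Runs (.loop k k' p c) S S'' (t + t' + 1)

/-! ### Compilation of structured programs to machines with several stacks -/

/-- The control points of a program. -/
def Cmd.Label : Cmd K A → Type
  | .skip | .push _ _ | .pop _ | .copy _ _ => Unit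
  | .seq c d => c.Label ⊕ d.Label
  | .ite _ _ _ c d => Option (c.Label ⊕ d.Label)
  | .loop _ _ _ c => Option c.Label

instance Cmd.finiteLabel : (c : Cmd K A) → Finite c.Label
  | .skip | .push _ _ | .pop _ | .copy _ _ => inferInstanceAs (Finite Unit)
  | .seq c d =>
    have := c.finiteLabel
    have := d.finiteLabel
    inferInstanceAs (Finite (c.Label ⊕ d.Label))
  | .ite _ _ _ c d =>
    have := c.finiteLabel
    have := d.finiteLabel
    inferInstanceAs (Finite (Option (c.Label ⊕ d.Label)))
  | .loop _ _ _ c =>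
    have := c.finiteLabel
    inferInstanceAs (Finite (Option c.Label))

/-- The control point where the execution of a program begins. -/
def Cmd.entry : (c : Cmd K A) → c.Label
  | .skip | .push _ _ | .pop _ | .copy _ _ => ()
  | .seq c _ => .inl c.entry
  | .ite _ _ _ _ _ => none
  | .loop _ _ _ _ => none

/-- The stack alphabets of the machine for a program: one more stack holds the output. -/
def Alphabet (K A : Type) : Option K → Type
  | none => Bool
  | some _ => A

/-- The internal states of the machine for a program: two registers for top symbols. -/
abbrev Registers (A : Type) : Type := Option A × Option A

/-- Load the registers with the top symbols of two stacks, branch, and clear the registers. -/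
def testStmt {Λ : Type} (k k' : K) (p : Option A → Option A → Bool) (l l' : Λ) :
    TM2.Stmt (Alphabet K A) Λ (Registers A) :=
  .peek (some k) (fun s o => (o, s.2)) <| .peek (some k') (fun s o => (s.1, o)) <|
    .branch (fun s => p s.1 s.2) (.load (fun _ => (none, none)) (.goto fun _ => l))
      (.load (fun _ => (none, none)) (.goto fun _ => l'))

/-- The statements of the machine for a program, at each of the control points of the program. -/
def Cmd.code [Inhabited A] {Λ : Type} : (c : Cmd K A) → (c.Label → Λ) → Λ → c.Label →
    TM2.Stmt (Alphabet K A) Λ (Registers A)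
  | .skip, _, exit, _ => .goto fun _ => exit
  | .push k a, _, exit, _ => .push (some k) (fun _ => (a : A)) (.goto fun _ => exit)
  | .pop k, _, exit, _ => .pop (some k) (fun s _ => s) (.goto fun _ => exit)
  | .copy k k', _, exit, _ =>
    .peek (some k) (fun s o => (o, s.2)) <| .branch (fun s => s.1.isSome)
      -- `default` is never pushed: this branch is taken only if the register holds a symbol.
      (.push (some k') (fun s => (s.1.getD default : A))
        (.load (fun _ => (none, none)) (.goto fun _ => exit)))
      (.load (fun _ => (none, none)) (.goto fun _ => exit))
  | .seq c d, emb, _, .inl l => c.code (fun l => emb (.inl l)) (emb (.inr d.entry)) l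
  | .seq _ d, emb, exit, .inr l => d.code (fun l => emb (.inr l)) exit l
  | .ite k k' p c d, emb, _, none =>
    testStmt k k' p (emb (some (.inl c.entry))) (emb (some (.inr d.entry)))
  | .ite _ _ _ c _, emb, exit, some (.inl l) => c.code (fun l => emb (some (.inl l))) exit l
  | .ite _ _ _ _ d, emb, exit, some (.inr l) => d.code (fun l => emb (some (.inr l))) exit l
  | .loop k k' p c, emb, exit, none => testStmt k k' p (emb (some c.entry)) exit
  | .loop _ _ _ c, emb, _, some l => c.code (fun l => emb (some l)) (emb none) l

/-- The stacks of the machine while it executes a program. -/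
def machineStacks (S : K → List A) (out : List Bool) : (k : Option K) → List (Alphabet K A k)
  | none => out
  | some k => S k

theorem update_machineStacks (S : K → List A) (out : List Bool) (k : K) (l : List A) :
    update (machineStacks S out) (some k) l = machineStacks (update S k l) out := by
  funext k'
  cases k' with
  | none => exact update_of_ne (by simp) _ _
  | some k' =>
    by_cases h : k' = k
    · subst h
      exact (update_self (some k') l (machineStacks S out)).trans (update_self k' l S).symm
    · exact (update_of_ne (by simpa using h) _ _).trans (update_of_ne h _ _).symm

/-- The machine `M` gets from one configuration to another in `t` steps. -/
def Reaches {Λ σ : Type} {Γ : Option K → Type} (M : Λ → TM2.Stmt Γ Λ σ) (a b : TM2.Cfg Γ Λ σ)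
    (t : ℕ) : Prop :=
  (flip bind (TM2.step M))^[t] (some a) = some b

theorem Reaches.trans {Λ σ : Type} {Γ : Option K → Type} {M : Λ → TM2.Stmt Γ Λ σ}
    {a b c : TM2.Cfg Γ Λ σ} {t t' : ℕ} (h : Reaches M a b t) (h' : Reaches M b c t') :
    Reaches M a c (t + t') := by
  unfold Reaches at *
  rw [Nat.add_comm, iterate_add_apply, h, h']

theorem Reaches.single {Λ σ : Type} {Γ : Option K → Type} {M : Λ → TM2.Stmt Γ Λ σ}
    {a b : TM2.Cfg Γ Λ σ} (h : TM2.step M a = some b) : Reaches M a b 1 := h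

/-- The registers are empty again after the branch, so all control points are entered in the same
internal state. -/
theorem step_testStmt {Λ : Type} {M : Λ → TM2.Stmt (Alphabet K A) Λ (Registers A)} {l₀ l l' : Λ}
    {k k' : K} {p : Option A → Option A → Bool} (h : M l₀ = testStmt k k' p l l')
    (S : K → List A) (out : List Bool) :
    TM2.step M ⟨some l₀, (none, none), machineStacks S out⟩ =
      some ⟨some (cond (p (S k).head? (S k').head?) l l'), (none, none), machineStacks S out⟩ := by
  rw [TM2.step, h]
  change some (cond (p (S k).head? (S k').head?) _ _) = _
  cases p (S k).head? (S k').head? <;> rfl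

/-- The program may be part of a larger one: `emb` places its control points in `M`, and `exit` is
where control goes afterwards. `Runs` counts machine steps exactly; sequencing is free because the
first program exits directly to the entry of the second one. -/
theorem Runs.reaches [Inhabited A] {c : Cmd K A} {S S' : K → List A} {t : ℕ} (h : Runs c S S' t)
    {Λ : Type} (M : Λ → TM2.Stmt (Alphabet K A) Λ (Registers A)) (emb : c.Label → Λ) (exit : Λ)
    (hM : ∀ l, M (emb l) = c.code emb exit l) (out : List Bool) :
    Reaches M ⟨some (emb c.entry), (none, none), machineStacks S out⟩
      ⟨some exit, (none, none), machineStacks S' out⟩ t := by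
  induction h generalizing exit with
  | skip S => exact .single (by rw [TM2.step, hM]; rfl)
  | push S k a =>
    refine .single ?_
    rw [TM2.step, hM, ← update_machineStacks]
    rfl
  | pop S k =>
    refine .single ?_
    rw [TM2.step, hM, ← update_machineStacks]
    rfl
  | copy S k k' =>
    refine .single ?_
    rw [TM2.step, hM, ← update_machineStacks]
    change some (cond (S k).head?.isSome _ _) = _
    rcases hk : (S k).head? with _ | a
    · simp only [Option.isSome_none, Option.toList_none, List.nil_append, cond_false]
      rw [update_machineStacks, update_eq_self]
      rfl
    · change some (TM2.stepAux _ ((S k).head?, none) _) = _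
      rw [hk]
      rfl
  | seq _ _ ih ih' =>
    exact (ih _ _ fun l => hM (.inl l)).trans (ih' _ _ fun l => hM (.inr l))
  | ite_true hp _ ih =>
    rw [Nat.add_comm]
    refine .trans (.single (step_testStmt (hM none) _ _)) ?_
    rw [hp]
    exact ih _ _ fun l => hM (some (.inl l))
  | ite_false hp _ ih =>
    rw [Nat.add_comm]
    refine .trans (.single (step_testStmt (hM none) _ _)) ?_
    rw [hp]
    exact ih _ _ fun l => hM (some (.inr l))
  | loop_done hp =>
    refine .single ?_
    rename_i S
    have := step_testStmt (hM none) S out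
    rw [hp] at this
    exact this
  | loop_step hp _ _ ih ih' =>
    rename_i t t' _ _
    rw [show t + t' + 1 = 1 + t + t' by omega]
    -- The exit of the loop body is the test of the loop.
    refine (Reaches.single (step_testStmt (hM none) _ _)).trans ?_ |>.trans (ih' _ _ hM)
    rw [hp]
    exact ih _ _ fun l => hM (some l)

/-- A program that leaves its answer on top of one stack and empties all others gives a machine. -/
theorem decidableInPolyTime_of_runs [Inhabited A] [Fintype A] [Fintype K] {α : Type}
    {enc : α → List A} {P : α → Prop} (c : Cmd K A) (input value : K) (accept : A → Bool)
    (p : Polynomial ℕ)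
    (h : ∀ a, ∃ s, (accept s = true ↔ P a) ∧ ∃ t ≤ p.eval (enc a).length,
      Runs c (update (fun _ => []) input (enc a)) (update (fun _ => []) value [s]) t) :
    TermRewriting.DecidableInPolyTime enc P := by
  classical
  choose s hs t ht hrun using h
  refine ⟨fun a => accept (s a), hs, ⟨?_⟩⟩
  have : Fintype c.Label := Fintype.ofFinite _
  -- The final configuration must have the initial internal state and nothing but the answer on its
  -- stacks; one extra step pops the value and writes the output bit.
  let output : TM2.Stmt (Alphabet K A) (Option c.Label) (Registers A) :=
    .push none (fun s => (accept (s.1.getD default) : Bool)) (.load (fun _ => (none, none)) .halt)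
  let last : TM2.Stmt (Alphabet K A) (Option c.Label) (Registers A) :=
    .pop (some value) (fun s o => (o, s.2)) output
  let M : Option c.Label → TM2.Stmt (Alphabet K A) (Option c.Label) (Registers A) :=
    fun l => l.elim last (c.code some none)
  let tm : FinTM2 :=
    { K := Option K
      k₀ := some input
      k₁ := none
      Γ := Alphabet K A
      Λ := Option c.Label
      main := some c.entry
      σ := Registers A
      initialState := (none, none)
      Γk₀Fin := inferInstanceAs (Fintype A)
      m := M }
  refine
    { tm := tm
      inputAlphabet := Equiv.refl A
      outputAlphabet := Equiv.refl Bool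
      time := p + 1
      outputsFun := fun a =>
        { steps := t a + 1
          evals_in_steps := ?_
          steps_le_m := by simpa using ht a } }
  have hstart : initList tm (enc a) = ⟨some (some c.entry), (none, none),
      machineStacks (update (fun _ => []) input (enc a)) []⟩ := by
    unfold initList
    congr 1
    funext k
    cases k with
    | none => exact dif_neg (by simp [tm])
    | some k =>
      by_cases hk : k = input
      · subst hk
        exact (dif_pos rfl).trans (update_self k (enc a) (fun _ => [])).symm
      · exact (dif_neg (by simpa [tm] using hk)).trans (update_of_ne hk (enc a) (fun _ => [])).symm
  have hend : haltList tm [accept (s a)] = ⟨none, (none, none),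
      machineStacks (fun _ => []) [accept (s a)]⟩ := by
    unfold haltList
    congr 1
    funext k
    cases k with
    | none => exact dif_pos rfl
    | some k => exact dif_neg (by simp [tm])
  have hreach := (hrun a).reaches M some none (fun _ => rfl) []
  have hlast : Reaches M ⟨some none, (none, none),
      machineStacks (update (fun _ => []) value [s a]) []⟩ ⟨none, (none, none),
      machineStacks (fun _ => []) [accept (s a)]⟩ 1 := by
    refine .single ?_
    change some (TM2.stepAux last _ _) = _
    let U : K → List A := update (fun _ => []) value [s a]
    have hU : U value = [s a] := update_self ..
    have hU' : update U value [] = fun _ => [] := by simp [U]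
    change some (TM2.stepAux output (((U value).head?, none) : Registers A)
      (update (machineStacks U []) (some value) (U value).tail)) = _
    rw [update_machineStacks, hU, List.tail_cons, hU']
    change some (TM2.Cfg.mk _ _ _) = some (TM2.Cfg.mk _ _ _)
    congr 2
    funext k
    cases k with
    | none => exact update_self ..
    | some k => exact update_of_ne (by simp) _ _
  have := hreach.trans hlast
  unfold Reaches at this
  rw [← hend, ← hstart] at this
  exact (congrArg (fun l : List A => (flip bind (TM2.step M))^[t a + 1] (some (initList tm l)))
    (List.map_id (enc a))).trans this

end StackProgram

/-! ### Running time bounds for structured programs -/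

namespace StackProgram

open Function

variable {K A : Type} [DecidableEq K]

/-- The program `c` transforms the stacks `S` into `S'` in at most `T` steps. -/
def RunsIn (c : Cmd K A) (S S' : K → List A) (T : ℕ) : Prop :=
  ∃ t ≤ T, Runs c S S' t

theorem Runs.runsIn {c : Cmd K A} {S S' : K → List A} {t : ℕ} (h : Runs c S S' t) :
    RunsIn c S S' t := ⟨t, le_rfl, h⟩

namespace RunsIn

variable {c d : Cmd K A} {S S' S'' : K → List A} {T T' : ℕ} {k k' : K}
  {p : Option A → Option A → Bool}

theorem mono (h : RunsIn c S S' T) (hT : T ≤ T') : RunsIn c S S' T' :=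
  let ⟨t, ht, hr⟩ := h
  ⟨t, ht.trans hT, hr⟩

theorem of_eq (h : RunsIn c S S' T) (hS : S' = S'') (hT : T ≤ T') : RunsIn c S S'' T' :=
  hS ▸ h.mono hT

theorem seq (h : RunsIn c S S' T) (h' : RunsIn d S' S'' T') :
    RunsIn (.seq c d) S S'' (T + T') :=
  let ⟨_, ht, hr⟩ := h
  let ⟨_, ht', hr'⟩ := h'
  ⟨_, Nat.add_le_add ht ht', hr.seq hr'⟩

theorem ite (h : p (S k).head? (S k').head? = true → RunsIn c S S' T)
    (h' : p (S k).head? (S k').head? = false → RunsIn d S S' T) :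
    RunsIn (.ite k k' p c d) S S' (T + 1) := by
  cases hp : p (S k).head? (S k').head?
  · obtain ⟨t, ht, hr⟩ := h' hp
    exact ⟨t + 1, by omega, .ite_false hp hr⟩
  · obtain ⟨t, ht, hr⟩ := h hp
    exact ⟨t + 1, by omega, .ite_true hp hr⟩

/-- A loop runs through a sequence of stack contents. -/
theorem loop (f : ℕ → K → List A) (n : ℕ)
    (hstep : ∀ i < n, p (f i k).head? (f i k').head? = true ∧ RunsIn c (f i) (f (i + 1)) T)
    (hdone : p (f n k).head? (f n k').head? = false) :
    RunsIn (.loop k k' p c) (f 0) (f n) (n * (T + 1) + 1) := by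
  -- The induction is on the number of iterations still to come, as `Runs.loop_step` adds an
  -- iteration in front.
  suffices h : ∀ j ≤ n, RunsIn (.loop k k' p c) (f (n - j)) (f n) (j * (T + 1) + 1) by
    simpa using h n le_rfl
  intro j hj
  induction j with
  | zero => exact (Runs.loop_done hdone).runsIn.mono (by simp)
  | succ j ih =>
    obtain ⟨t, ht, hr⟩ := ih (by omega)
    obtain ⟨hp, t', ht', hr'⟩ := hstep (n - (j + 1)) (by omega)
    rw [show n - (j + 1) + 1 = n - j by omega] at hr'
    refine ⟨_, ?_, .loop_step hp hr' hr⟩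
    rw [Nat.succ_mul]
    omega

/-- Move the top symbol of a stack to another stack. -/
def _root_.StackProgram.Cmd.move (k k' : K) : Cmd K A := .seq (.copy k k') (.pop k)

theorem move {a : A} {l : List A} (hk : k ≠ k') (h : S k = a :: l) :
    RunsIn (.move k k') S (update (update S k' (a :: S k')) k l) 2 := by
  have := (Runs.copy S k k').runsIn.seq (Runs.pop _ k).runsIn
  rw [update_of_ne hk, h] at this
  exact this

/-- Empty a stack. -/
def _root_.StackProgram.Cmd.clear (k : K) : Cmd K A := .loop k k (fun o _ => o.isSome) (.pop k)

theorem clear (S : K → List A) (k : K) :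
    RunsIn (.clear k) S (update S k []) ((S k).length * 2 + 1) := by
  suffices h : RunsIn (.clear k) (update S k ((S k).drop 0)) (update S k ((S k).drop (S k).length))
      ((S k).length * 2 + 1) by simpa using h
  refine loop (fun i => update S k ((S k).drop i)) (S k).length (T := 1) ?_ ?_
  · intro i hi
    refine ⟨by simpa [List.head?_drop] using hi, ?_⟩
    have := (Runs.pop (update S k ((S k).drop i)) k).runsIn
    simpa using this
  · simp

end RunsIn

end StackProgram

/-! ### Polynomial time properties of positions of a word -/

namespace WordLogic

open StackProgram Function TermRewriting

/-- The stacks of the programs that decide properties of positions of a word. There are `k` slots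
for positions; the word is split at each position. -/
inductive Stk (k : ℕ) : Type
  | left (i : Fin k)
  | right (i : Fin k)
  | count (b : Bool) (i : Fin k)
  | value
  | scratch
  deriving DecidableEq, Fintype

instance : Inhabited Letter := ⟨.system⟩

/-- The slot of a variable, in a context of `n` variables: the last variable has slot `0`. -/
def slot {n k : ℕ} (h : n ≤ k) (i : Fin n) : Fin k := ⟨n - 1 - i, by omega⟩

theorem slot_injective {n k : ℕ} (h : n ≤ k) : Injective (slot h) := by
  intro i j hij
  simp only [slot, Fin.mk.injEq] at hij
  omega

-- Slots are numbered from the oldest variable on, so a newly bound variable leaves all others in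
-- their slots.
@[simp] theorem slot_succ {n k : ℕ} (h : n + 1 ≤ k) (i : Fin n) :
    slot h i.succ = slot (Nat.le_of_succ_le h) i := by
  simp only [slot, Fin.val_succ, Fin.mk.injEq]
  omega

theorem val_slot_zero {n k : ℕ} (h : n + 1 ≤ k) : (slot h 0 : ℕ) = n := by simp [slot]

/-- The stacks represent a word `w` and `n` positions in it, and the other slots are unused. -/
structure Represents {n k : ℕ} (h : n ≤ k) (w : List Letter) (v : Fin n → ℕ)
    (S : Stk k → List Letter) : Prop where
  left : ∀ i, S (.left (slot h i)) = (w.take (v i)).reverse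
  right : ∀ i, S (.right (slot h i)) = w.drop (v i)
  left_free : ∀ l : Fin k, n ≤ l → S (.left l) = []
  right_free : ∀ l : Fin k, n ≤ l → S (.right l) = w
  count_free : ∀ b (l : Fin k), n ≤ l → S (.count b l) = []
  scratch : S .scratch = []

/-- Push a truth value on the value stack. -/
def pushValue {k : ℕ} (S : Stk k → List Letter) (b : Bool) : Stk k → List Letter :=
  update S .value (.bit b :: S .value)

open scoped Classical in
/-- A property of words and `n` positions in them that programs can decide in polynomial time. -/
def Dec (n : ℕ) (P : List Letter → (Fin n → ℕ) → Prop) : Prop :=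
  ∃ m, ∀ k (h : n + m ≤ k), ∃ (c : Cmd (Stk k) Letter) (p : Polynomial ℕ), ∀ w v S,
    (∀ i, v i < w.length) → Represents (Nat.le_of_add_right_le h) w v S →
      RunsIn c S (pushValue S (decide (P w v))) (p.eval w.length)

/-! ### Boolean connectives and letter conditions -/

namespace Dec

variable {n : ℕ} {P Q : List Letter → (Fin n → ℕ) → Prop}

theorem congr (h : ∀ w v, (∀ i, v i < w.length) → (P w v ↔ Q w v)) (hP : Dec n P) : Dec n Q := by
  obtain ⟨m, hm⟩ := hP
  refine ⟨m, fun k hk => ?_⟩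
  obtain ⟨c, p, hc⟩ := hm k hk
  refine ⟨c, p, fun w v S hv hS => ?_⟩
  have := hc w v S hv hS
  rwa [show (P w v) = (Q w v) from propext (h w v hv)] at this

/-- Test the truth value on top of the value stack. -/
def testValue {k : ℕ} (c d : Cmd (Stk k) Letter) : Cmd (Stk k) Letter :=
  .ite .value .value (fun o _ => o = some (.bit true)) c d

theorem runsIn_testValue {k : ℕ} {c d : Cmd (Stk k) Letter} {S S' : Stk k → List Letter} {b : Bool}
    {T : ℕ} (h : b = true → RunsIn c (pushValue S b) S' T)
    (h' : b = false → RunsIn d (pushValue S b) S' T) :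
    RunsIn (testValue c d) (pushValue S b) S' (T + 1) := by
  refine .ite (fun hp => h ?_) (fun hp => h' ?_) <;> simpa [pushValue] using hp

theorem runsIn_pop_pushValue {k : ℕ} (S : Stk k → List Letter) (b : Bool) :
    RunsIn (.pop .value) (pushValue S b) S 1 := by
  have := (Runs.pop (pushValue S b) .value).runsIn
  simpa [pushValue] using this

theorem not (hP : Dec n P) : Dec n fun w v => ¬ P w v := by
  classical
  obtain ⟨m, hm⟩ := hP
  refine ⟨m, fun k hk => ?_⟩
  obtain ⟨c, p, hc⟩ := hm k hk
  refine ⟨.seq c (testValue (.seq (.pop .value) (.push .value (.bit false)))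
    (.seq (.pop .value) (.push .value (.bit true)))), p + 3, fun w v S hv hS => ?_⟩
  refine ((hc w v S hv hS).seq (runsIn_testValue (T := 2) ?_ ?_)).mono (by simp)
  all_goals
    intro h
    refine ((runsIn_pop_pushValue _ _).seq (Runs.push _ _ _).runsIn).of_eq ?_ (by simp)
    simp at h
    simp [pushValue, h]

theorem and (hP : Dec n P) (hQ : Dec n Q) : Dec n fun w v => P w v ∧ Q w v := by
  classical
  obtain ⟨m, hm⟩ := hP
  obtain ⟨m', hm'⟩ := hQ
  -- The conjuncts are evaluated one after the other and share their spare slots; both have programs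
  -- for every sufficiently large number of slots.
  refine ⟨max m m', fun k hk => ?_⟩
  obtain ⟨c, p, hc⟩ := hm k (by omega)
  obtain ⟨c', p', hc'⟩ := hm' k (by omega)
  refine ⟨.seq c (testValue (.seq (.pop .value) c') .skip), p + p' + 2, fun w v S hv hS => ?_⟩
  refine ((hc w v S hv hS).seq
    (runsIn_testValue (T := p'.eval w.length + 1) ?_ ?_)).mono ?_
  · intro h
    refine ((runsIn_pop_pushValue _ _).seq (hc' w v S hv hS)).of_eq ?_ (by omega)
    simp at h
    simp [h]
  · intro h
    refine (Runs.skip _).runsIn.of_eq ?_ (by simp)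
    simp at h
    simp [h]
  · simp; omega

/-- A condition on the letter at a position. -/
theorem letter (q : Letter → Bool) (i : Fin n) : Dec n fun w v => w[v i]?.any q = true := by
  classical
  refine ⟨0, fun k hk => ?_⟩
  refine ⟨.ite (.right (slot hk i)) (.right (slot hk i)) (fun o _ => o.any q)
    (.push .value (.bit true)) (.push .value (.bit false)), 2, fun w v S hv hS => ?_⟩
  refine (RunsIn.ite (T := 1) ?_ ?_).mono (by simp)
  all_goals
    intro h
    refine (Runs.push _ _ _).runsIn.of_eq ?_ le_rfl
    simp only [pushValue]
    congr 3
    rw [hS.right, List.head?_drop] at h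
    simp [h]

/-- The letter `a` is the one that changes stacks when a position moves by one. -/
theorem exists_split {w : List Letter} {i : ℕ} (h : i < w.length) : ∃ a,
    w.drop i = a :: w.drop (i + 1) ∧ (w.take (i + 1)).reverse = a :: (w.take i).reverse :=
  ⟨w[i], List.drop_eq_getElem_cons h, by rw [List.take_succ_eq_append_getElem h]; simp⟩

/-! ### Order of positions and equality of names by parallel scans -/

/-- Move two positions one letter to the right and count the moves. -/
def advance {k : ℕ} (x y : Fin k) : Cmd (Stk k) Letter :=
  .seq (.move (.right x) (.left x)) (.seq (.move (.right y) (.left y)) (.push .scratch .system))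

/-- Move two positions one letter to the left and undo the count of the moves. -/
def retreat {k : ℕ} (x y : Fin k) : Cmd (Stk k) Letter :=
  .seq (.move (.left x) (.right x)) (.seq (.move (.left y) (.right y)) (.pop .scratch))

/-- Move two positions to the right as long as the letters meet a condition, evaluate a property
of the letters found, and move the positions back. -/
def scan {k : ℕ} (x y : Fin k) (c r : Option Letter → Option Letter → Bool) :
    Cmd (Stk k) Letter :=
  .seq (advance x y) <| .seq (.loop (.right x) (.right y) c (advance x y)) <|
    .seq (.ite (.right x) (.right y) r (.push .value (.bit true)) (.push .value (.bit false))) <|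
      .loop .scratch .scratch (fun o _ => o.isSome) (retreat x y)

/-- The stacks during a scan. -/
def scanStacks {k : ℕ} (x y : Fin k) (w : List Letter) (a b : ℕ) (S : Stk k → List Letter) (j : ℕ) :
    Stk k → List Letter
  | .left z => if z = x then (w.take (a + j)).reverse else
      if z = y then (w.take (b + j)).reverse else S (.left z)
  | .right z => if z = x then w.drop (a + j) else if z = y then w.drop (b + j) else S (.right z)
  | .scratch => List.replicate j .system
  | .value => S .value
  | .count b z => S (.count b z)

theorem runsIn_advance {k : ℕ} {x y : Fin k} (hxy : x ≠ y) (w : List Letter) (a b : ℕ)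
    (S : Stk k → List Letter) (j : ℕ) (ha : a + j < w.length) (hb : b + j < w.length) :
    RunsIn (advance x y) (scanStacks x y w a b S j) (scanStacks x y w a b S (j + 1)) 5 := by
  obtain ⟨p, hp, hp'⟩ := exists_split ha
  obtain ⟨q, hq, hq'⟩ := exists_split hb
  refine ((RunsIn.move (a := p) (l := w.drop (a + j + 1)) (by simp) ?_).seq
    ((RunsIn.move (a := q) (l := w.drop (b + j + 1)) (by simp) ?_).seq
    (Runs.push _ _ _).runsIn)).of_eq ?_ le_rfl
  · simp [scanStacks, hp]
  · simp [scanStacks, hxy.symm, hq]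
  · funext s
    rcases s with z | z | ⟨c, z⟩ | _ | _
    · obtain rfl | hx := eq_or_ne z x
      · simp [scanStacks, hxy, ← Nat.add_assoc, hp']
      · obtain rfl | hy := eq_or_ne z y
        · simp [scanStacks, hx, ← Nat.add_assoc, hq']
        · simp [scanStacks, hx, hy]
    · obtain rfl | hx := eq_or_ne z x
      · simp [scanStacks, hxy, ← Nat.add_assoc]
      · obtain rfl | hy := eq_or_ne z y
        · simp [scanStacks, hx, ← Nat.add_assoc]
        · simp [scanStacks, hx, hy]
    all_goals simp [scanStacks, List.replicate_succ]

theorem runsIn_retreat {k : ℕ} {x y : Fin k} (hxy : x ≠ y) (w : List Letter) (a b : ℕ)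
    (S : Stk k → List Letter) (j : ℕ) (ha : a + j < w.length) (hb : b + j < w.length) :
    RunsIn (retreat x y) (scanStacks x y w a b S (j + 1)) (scanStacks x y w a b S j) 5 := by
  obtain ⟨p, hp, hp'⟩ := exists_split ha
  obtain ⟨q, hq, hq'⟩ := exists_split hb
  refine ((RunsIn.move (a := p) (l := (w.take (a + j)).reverse) (by simp) ?_).seq
    ((RunsIn.move (a := q) (l := (w.take (b + j)).reverse) (by simp) ?_).seq
    (Runs.pop _ _).runsIn)).of_eq ?_ le_rfl
  · simp [scanStacks, ← Nat.add_assoc, hp']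
  · simp [scanStacks, hxy.symm, ← Nat.add_assoc, hq']
  · funext s
    rcases s with z | z | ⟨c, z⟩ | _ | _
    · obtain rfl | hx := eq_or_ne z x
      · simp [scanStacks, hxy]
      · obtain rfl | hy := eq_or_ne z y
        · simp [scanStacks, hx]
        · simp [scanStacks, hx, hy]
    · obtain rfl | hx := eq_or_ne z x
      · simp [scanStacks, hxy, ← Nat.add_assoc, hp]
      · obtain rfl | hy := eq_or_ne z y
        · simp [scanStacks, hx, ← Nat.add_assoc, hq]
        · simp [scanStacks, hx, hy]
    all_goals simp [scanStacks, List.replicate_succ]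

/-- Here `j` is the number of tests that succeed. The first move is unconditional, so the tests see
only letters after the two positions, and `.scratch` collects `j + 1` marks for the way back. The
phases take 12 j + 15 steps in all, and j is less than the length of the word. -/
theorem runsIn_scan {k : ℕ} {x y : Fin k} (hxy : x ≠ y) (w : List Letter) (a b : ℕ)
    (c r : Option Letter → Option Letter → Bool) (S : Stk k → List Letter) (j : ℕ)
    (hx : S (.left x) = (w.take a).reverse) (hy : S (.left y) = (w.take b).reverse)
    (hx' : S (.right x) = w.drop a) (hy' : S (.right y) = w.drop b) (hS : S .scratch = [])
    (hj : ∀ i < j + 1, a + i < w.length ∧ b + i < w.length)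
    (hstep : ∀ i < j, c w[a + 1 + i]? w[b + 1 + i]? = true)
    (hdone : c w[a + 1 + j]? w[b + 1 + j]? = false) :
    RunsIn (scan x y c r) S (pushValue S (r w[a + 1 + j]? w[b + 1 + j]?)) (12 * w.length + 20) := by
  have hS0 : scanStacks x y w a b S 0 = S := by
    funext s
    rcases s with z | z | ⟨c, z⟩ | _ | _
    · by_cases h : z = x <;> by_cases h' : z = y <;> simp_all [scanStacks]
    · by_cases h : z = x <;> by_cases h' : z = y <;> simp_all [scanStacks]
    all_goals simp [scanStacks, hS]
  have hright : ∀ S i, (scanStacks x y w a b S i (.right x)).head? = w[a + i]? ∧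
      (scanStacks x y w a b S i (.right y)).head? = w[b + i]? := by
    intro S i
    simp [scanStacks, hxy.symm, List.head?_drop]
  have h1 := runsIn_advance hxy w a b S 0 (hj 0 (by omega)).1 (hj 0 (by omega)).2
  have h2 : RunsIn (.loop (.right x) (.right y) c (advance x y)) (scanStacks x y w a b S (0 + 1))
      (scanStacks x y w a b S (j + 1)) (j * (5 + 1) + 1) := by
    refine .loop (fun i => scanStacks x y w a b S (i + 1)) j (fun i hi => ⟨?_, ?_⟩) ?_
    · have := hright S (i + 1)
      rw [this.1, this.2, Nat.add_comm i, ← Nat.add_assoc, ← Nat.add_assoc]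
      exact hstep i hi
    · have := hj (i + 1) (by omega)
      exact runsIn_advance hxy w a b S (i + 1) this.1 this.2
    · have := hright S (j + 1)
      rw [this.1, this.2, Nat.add_comm j, ← Nat.add_assoc, ← Nat.add_assoc]
      exact hdone
  set v := r w[a + 1 + j]? w[b + 1 + j]? with hv
  have h3 : RunsIn (.ite (.right x) (.right y) r (.push .value (.bit true))
      (.push .value (.bit false))) (scanStacks x y w a b S (j + 1))
      (scanStacks x y w a b (pushValue S v) (j + 1)) (1 + 1) := by
    have hpush : pushValue (scanStacks x y w a b S (j + 1)) v =
        scanStacks x y w a b (pushValue S v) (j + 1) := by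
      funext s
      cases s <;> simp [pushValue, scanStacks]
    have := hright S (j + 1)
    rw [Nat.add_comm j, ← Nat.add_assoc, ← Nat.add_assoc] at this
    rw [Nat.add_comm j] at hpush ⊢
    refine .ite (fun h => ?_) (fun h => ?_) <;>
    · rw [this.1, this.2, ← hv] at h
      refine (Runs.push _ _ _).runsIn.of_eq ?_ le_rfl
      rw [← hpush, h]
      rfl
  have h4 : RunsIn (.loop .scratch .scratch (fun o _ => o.isSome) (retreat x y))
      (scanStacks x y w a b (pushValue S v) (j + 1 - 0))
      (scanStacks x y w a b (pushValue S v) (j + 1 - (j + 1))) ((j + 1) * (5 + 1) + 1) := by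
    refine .loop (fun i => scanStacks x y w a b (pushValue S v) (j + 1 - i)) (j + 1)
      (fun i hi => ⟨?_, ?_⟩) ?_
    · simp only [scanStacks, List.head?_replicate]
      simp
      omega
    · have := hj (j - i) (by omega)
      have := runsIn_retreat hxy w a b (pushValue S v) (j - i) this.1 this.2
      rwa [show j + 1 - i = j - i + 1 by omega, show j + 1 - (i + 1) = j - i by omega]
    · simp [scanStacks]
  have h0 : scanStacks x y w a b (pushValue S v) 0 = pushValue S v := by
    conv_rhs => rw [← hS0]
    funext s
    cases s <;> simp [scanStacks, pushValue]
  rw [hS0] at h1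
  refine (h1.seq (h2.seq (h3.seq h4))).of_eq ?_ ?_
  · simpa using h0
  · have := hj j (by omega)
    omega

/-- The longest word of binary digits that starts right after a position. -/
def bitsAfter (w : List Letter) (x : ℕ) : List Letter :=
  (w.drop (x + 1)).takeWhile fun a => a matches .bit _

/-- Leaves only a statement about letters: after `N` successful tests the scan stops, and `r` reads
off the answer there. The variables must be distinct because a scan moves two different slots. -/
theorem scan_dec {n : ℕ} {i j : Fin n} (hij : i ≠ j) (c r : Option Letter → Option Letter → Bool)
    (P : List Letter → ℕ → ℕ → Prop)
    (h : ∀ w : List Letter, ∀ a < w.length, ∀ b < w.length, ∃ N,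
      (∀ i < N, a + 1 + i < w.length ∧ b + 1 + i < w.length) ∧
      (∀ i < N, c w[a + 1 + i]? w[b + 1 + i]? = true) ∧
      c w[a + 1 + N]? w[b + 1 + N]? = false ∧ (r w[a + 1 + N]? w[b + 1 + N]? = true ↔ P w a b)) :
    Dec n fun w v => P w (v i) (v j) := by
  classical
  refine ⟨0, fun k hk => ⟨scan (slot hk i) (slot hk j) c r, 12 * .X + 20, fun w v S hv hS => ?_⟩⟩
  obtain ⟨N, h1, h2, h3, h4⟩ := h w (v i) (hv i) (v j) (hv j)
  refine (runsIn_scan ((slot_injective hk).ne hij) w (v i) (v j) c r S N (hS.left i) (hS.left j)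
    (hS.right i) (hS.right j) hS.scratch ?_ h2 h3).of_eq ?_ (by simp)
  · intro l hl
    rcases l with _ | l
    · exact ⟨hv i, hv j⟩
    · have := h1 l (by omega)
      omega
  · congr 1
    rw [Bool.eq_iff_iff, h4, decide_eq_true_iff]

theorem lt (i j : Fin n) : Dec n fun _ v => v i < v j := by
  by_cases hij : i = j
  · subst hij
    exact ((letter (fun _ => false) i).congr (by simp))
  -- The scan stops when one position reaches the end of the word; the first one then has letters
  -- left exactly if it was the smaller one.
  · refine scan_dec hij (fun a b => a.isSome && b.isSome) (fun a _ => a.isSome)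
      (fun _ a b => a < b) fun w a ha b hb => ?_
    refine ⟨min (w.length - (a + 1)) (w.length - (b + 1)), ?_, ?_, ?_, ?_⟩
    · intro i hi
      omega
    · intro i hi
      simp
      omega
    · simp
      omega
    · simp
      omega

/-- Scan as long as both letters are the same digit. The two words of digits are equal exactly if
the scan stops at a digit on neither side. -/
theorem sameBits {i j : Fin n} (hij : i ≠ j) :
    Dec n fun w v => bitsAfter w (v i) = bitsAfter w (v j) := by
  let isBit : Letter → Bool := fun a => a matches .bit _
  have key : ∀ u u' : List Letter, ∃ N, (∀ i < N, i < u.length ∧ i < u'.length) ∧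
      (∀ i < N, (u[i]?.any isBit && u[i]? == u'[i]?) = true) ∧
      (u[N]?.any isBit && u[N]? == u'[N]?) = false ∧
      ((!u[N]?.any isBit && !u'[N]?.any isBit) = true ↔ u.takeWhile isBit = u'.takeWhile isBit) := by
    intro u
    induction u with
    | nil =>
      intro u'
      refine ⟨0, by simp, by simp, by simp, ?_⟩
      cases u' with
      | nil => simp
      | cons a u' => cases h : isBit a <;> simp [h]
    | cons a u ih =>
      intro u'
      cases u' with
      | nil =>
        refine ⟨0, by simp, by simp, by simp, ?_⟩
        cases h : isBit a <;> simp [h]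
      | cons b u' =>
        by_cases h : isBit a = true ∧ a = b
        · obtain ⟨ha, rfl⟩ := h
          obtain ⟨N, h1, h2, h3, h4⟩ := ih u'
          refine ⟨N + 1, ?_, ?_, by simpa using h3, ?_⟩
          · rintro (_ | i) hi
            · simp
            · simpa using h1 i (by omega)
          · rintro (_ | i) hi
            · simp [ha]
            · simpa using h2 i (by omega)
          · simpa [ha] using h4
        · refine ⟨0, by simp, by simp, by simpa using h, ?_⟩
          cases ha : isBit a <;> cases hb : isBit b <;> simp [ha, hb]
          intro hab
          exact absurd ⟨ha, hab⟩ h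
  refine scan_dec hij (fun a b => a.any isBit && a == b) (fun a b => !a.any isBit && !b.any isBit)
    (fun w a b => bitsAfter w a = bitsAfter w b) fun w a ha b hb => ?_
  obtain ⟨N, h1, h2, h3, h4⟩ := key (w.drop (a + 1)) (w.drop (b + 1))
  simp only [List.getElem?_drop, List.length_drop] at h1 h2 h3 h4
  exact ⟨N, fun i hi => by have := h1 i hi; omega, h2, h3, h4⟩

/-! ### The counting quantifier -/

/-- Evaluate `c` at all positions and count how often the value is true. -/
def tally {k : ℕ} (b : Bool) (x : Fin k) (c : Cmd (Stk k) Letter) : Cmd (Stk k) Letter :=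
  .seq (.loop (.right x) (.right x) (fun o _ => o.isSome) <|
    .seq c <| .seq (testValue (.push (.count b x) .system) .skip) <| .seq (.pop .value) <|
      .move (.right x) (.left x)) <|
    .loop (.left x) (.left x) (fun o _ => o.isSome) (.move (.left x) (.right x))

/-- The stacks during a tally. -/
def tallyStacks {k : ℕ} (b : Bool) (x : Fin k) (w : List Letter) (S : Stk k → List Letter)
    (j m : ℕ) : Stk k → List Letter
  | .left z => if z = x then (w.take j).reverse else S (.left z)
  | .right z => if z = x then w.drop j else S (.right z)
  | .scratch => S .scratch
  | .value => S .value
  | .count b' z => if b' = b ∧ z = x then List.replicate m .system else S (.count b' z)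

/-- Counters of slots in use are not constrained by `Represents`, so the body can run with any
intermediate count `m`. -/
theorem represents_tallyStacks {n k : ℕ} (h : n + 1 ≤ k) (b : Bool) (w : List Letter)
    (v : Fin n → ℕ) {S : Stk k → List Letter}
    (hS : Represents h w (Fin.cons 0 v : Fin (n + 1) → ℕ) S) (j m : ℕ) :
    Represents h w (Fin.cons j v : Fin (n + 1) → ℕ) (tallyStacks b (slot h 0) w S j m) := by
  have hne : ∀ l : Fin k, n + 1 ≤ l → l ≠ slot h 0 := by
    rintro l hl rfl
    rw [val_slot_zero] at hl
    omega
  constructor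
  · refine Fin.cases (by simp [tallyStacks]) fun i => ?_
    have := hS.left i.succ
    have hi : slot h i.succ ≠ slot h 0 := (slot_injective h).ne (Fin.succ_ne_zero i)
    simpa [tallyStacks, hi, -slot_succ] using this
  · refine Fin.cases (by simp [tallyStacks]) fun i => ?_
    have := hS.right i.succ
    have hi : slot h i.succ ≠ slot h 0 := (slot_injective h).ne (Fin.succ_ne_zero i)
    simpa [tallyStacks, hi, -slot_succ] using this
  · intro l hl
    simpa [tallyStacks, hne l hl] using hS.left_free l hl
  · intro l hl
    simpa [tallyStacks, hne l hl] using hS.right_free l hl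
  · intro b' l hl
    simpa [tallyStacks, hne l hl] using hS.count_free b' l hl
  · exact hS.scratch

/-- Invariant: after `j` positions the counter holds `Nat.count p j` marks. Each position costs `T +
5` steps for the body of the loop, one for its test, and three for moving back afterwards. -/
theorem runsIn_tally {n k : ℕ} (h : n + 1 ≤ k) (b : Bool) (c : Cmd (Stk k) Letter)
    (w : List Letter) (v : Fin n → ℕ) (S : Stk k → List Letter) (p : ℕ → Prop) [DecidablePred p]
    (hS : Represents h w (Fin.cons 0 v : Fin (n + 1) → ℕ) S)
    (hcount : S (.count b (slot h 0)) = []) (T : ℕ)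
    (hc : ∀ j < w.length, ∀ S', Represents h w (Fin.cons j v : Fin (n + 1) → ℕ) S' →
      RunsIn c S' (pushValue S' (p j)) T) :
    RunsIn (tally b (slot h 0) c) S
      (update S (.count b (slot h 0)) (List.replicate (Nat.count p w.length) .system))
      (w.length * (T + 9) + 2) := by
  have h3 := hS.left 0
  have h4 := hS.right 0
  simp only [Fin.cons_zero, List.take_zero, List.reverse_nil, List.drop_zero] at h3 h4
  set x := slot h 0 with hx_def
  have hS0 : tallyStacks b x w S 0 0 = S := by
    funext s
    rcases s with z | z | ⟨c, z⟩ | _ | _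
    · by_cases hx : z = x <;> simp [tallyStacks, hx, h3]
    · by_cases hx : z = x <;> simp [tallyStacks, hx, h4]
    · by_cases hx : c = b ∧ z = x
      · obtain ⟨rfl, rfl⟩ := hx
        simp [tallyStacks, hcount]
      · simp [tallyStacks, hx]
    all_goals simp [tallyStacks]
  have h1 := RunsIn.loop (k := Stk.right x) (k' := Stk.right x) (p := fun o _ => o.isSome)
    (c := .seq c <| .seq (testValue (.push (.count b x) .system) .skip) <| .seq (.pop .value) <|
      .move (.right x) (.left x))
    (fun j => tallyStacks b x w S j (Nat.count p j)) w.length (T := T + 5) (fun j hj => ⟨?_, ?_⟩)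
    (by simp [tallyStacks])
  · have h2 : RunsIn (.loop (.left x) (.left x) (fun o _ => o.isSome) (.move (.left x) (.right x)))
      (tallyStacks b x w S (w.length - 0) (Nat.count p w.length))
      (tallyStacks b x w S (w.length - w.length) (Nat.count p w.length))
      (w.length * (2 + 1) + 1) := by
      refine RunsIn.loop (fun j => tallyStacks b x w S (w.length - j) (Nat.count p w.length))
        w.length (fun j hj => ⟨?_, ?_⟩) (by simp [tallyStacks])
      · have : w ≠ [] := List.ne_nil_of_length_pos (by omega)
        simp [tallyStacks, this]
        omega
      · obtain ⟨i, hi⟩ : ∃ i, w.length - j = i + 1 := ⟨w.length - j - 1, by omega⟩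
        have hi' : w.length - (j + 1) = i := by omega
        have hlt : i < w.length := by omega
        rw [hi, hi']
        obtain ⟨q, hq, hq'⟩ := exists_split hlt
        refine (RunsIn.move (a := q) (l := (w.take i).reverse) (by simp) ?_).of_eq ?_ le_rfl
        · simp [tallyStacks, hq']
        · funext s
          rcases s with z | z | ⟨c, z⟩ | _ | _
          · by_cases hx : z = x <;> simp [tallyStacks, hx]
          · by_cases hx : z = x <;> simp [tallyStacks, hx, hq]
          all_goals simp [tallyStacks]
    rw [Nat.count_zero, hS0] at h1
    refine (h1.seq h2).of_eq ?_ (by ring_nf; omega)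
    rw [Nat.sub_self]
    funext s
    rcases s with z | z | ⟨c, z⟩ | _ | _
    · by_cases hx : z = x <;> simp [tallyStacks, hx, h3]
    · by_cases hx : z = x <;> simp [tallyStacks, hx, h4]
    · by_cases hx : c = b ∧ z = x <;> simp [tallyStacks, hx]
    all_goals simp [tallyStacks]
  · simp [tallyStacks, List.head?_drop]
    omega
  · obtain ⟨q, hq, hq'⟩ := exists_split hj
    have hrun := hc j hj _ (represents_tallyStacks h b w v hS j (Nat.count p j))
    have hpush : ∀ m, pushValue (tallyStacks b x w S j m) (p j) =
        tallyStacks b x w (pushValue S (p j)) j m := by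
      intro m
      funext s
      cases s <;> simp [pushValue, tallyStacks]
    have htest : RunsIn (testValue (.push (.count b x) .system) .skip)
        (pushValue (tallyStacks b x w S j (Nat.count p j)) (p j))
        (pushValue (tallyStacks b x w S j (Nat.count p (j + 1))) (p j)) (1 + 1) := by
      refine runsIn_testValue (fun hp => ?_) (fun hp => ?_)
      · refine (Runs.push _ _ _).runsIn.of_eq ?_ le_rfl
        simp only [decide_eq_true_eq] at hp
        rw [hpush, hpush, Nat.count_succ, if_pos hp]
        funext s
        rcases s with z | z | ⟨c, z⟩ | _ | _
        · simp [tallyStacks]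
        · simp [tallyStacks]
        · by_cases hx : c = b ∧ z = x <;>
            simp [tallyStacks, List.replicate_succ, hx]
        all_goals simp [tallyStacks]
      · simp only [decide_eq_false_iff_not] at hp
        rw [Nat.count_succ, if_neg hp]
        exact (Runs.skip _).runsIn
    refine (hrun.seq (htest.seq ((runsIn_pop_pushValue _ _).seq
      (RunsIn.move (a := q) (l := w.drop (j + 1)) (by simp) ?_)))).of_eq ?_ (by omega)
    · simp [tallyStacks, hq]
    · funext s
      rcases s with z | z | ⟨c, z⟩ | _ | _
      · by_cases hx : z = x <;> simp [tallyStacks, hx, hq']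
      · by_cases hx : z = x <;> simp [tallyStacks, hx]
      all_goals simp [tallyStacks]

/-- Compare the two counters of a slot and clear them. -/
def compare {k : ℕ} (x : Fin k) : Cmd (Stk k) Letter :=
  .seq (.loop (.count true x) (.count false x) (fun a b => a.isSome && b.isSome)
    (.seq (.pop (.count true x)) (.pop (.count false x)))) <|
  .seq (.ite (.count true x) (.count false x) (fun a b => a.isNone && b.isNone)
    (.push .value (.bit true)) (.push .value (.bit false))) <|
  .seq (.clear (.count true x)) (.clear (.count false x))

/-- The counters are unary. Marks are removed from both in parallel until one counter is empty; the
numbers were equal exactly if then both are empty. -/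
theorem runsIn_compare {k : ℕ} (x : Fin k) (S : Stk k → List Letter) (a b N : ℕ)
    (ha : S (.count true x) = List.replicate a .system)
    (hb : S (.count false x) = List.replicate b .system) (haN : a ≤ N) (hbN : b ≤ N) :
    RunsIn (compare x) S
      (pushValue (update (update S (.count true x) []) (.count false x) []) (a = b))
      (7 * N + 5) := by
  let f : ℕ → Stk k → List Letter := fun i => update
    (update S (.count true x) (List.replicate (a - i) .system))
    (.count false x) (List.replicate (b - i) .system)
  have hf0 : f 0 = S := by
    simp only [f, Nat.sub_zero, ← ha, ← hb]
    simp
  have h1 := RunsIn.loop (k := Stk.count true x) (k' := .count false x)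
    (p := fun a b => a.isSome && b.isSome) (T := 2)
    (c := .seq (.pop (.count true x)) (.pop (.count false x))) f (min a b)
    (fun i hi => ⟨?_, ?_⟩) ?_
  rotate_left
  · simp [f, List.head?_replicate]
    omega
  · refine ((Runs.pop _ _).runsIn.seq (Runs.pop _ _).runsIn).of_eq ?_ le_rfl
    funext s
    rcases s with z | z | ⟨c, z⟩ | _ | _
    · simp [f]
    · simp [f]
    · cases c <;> by_cases hz : z = x <;> simp [f, hz] <;> omega
    all_goals simp [f]
  · simp [f, List.head?_replicate]
    omega
  have h2 : RunsIn (.ite (.count true x) (.count false x) (fun a b => a.isNone && b.isNone)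
      (.push .value (.bit true)) (.push .value (.bit false))) (f (min a b))
      (pushValue (f (min a b)) (a = b)) (1 + 1) := by
    refine .ite (fun h => ?_) (fun h => ?_) <;>
    · refine (Runs.push _ _ _).runsIn.of_eq ?_ le_rfl
      unfold pushValue
      congr 3
      simp [f, List.head?_replicate] at h
      simp
      omega
  have h3 := RunsIn.clear (pushValue (f (min a b)) (a = b)) (.count true x)
  have h4 := RunsIn.clear (update (pushValue (f (min a b)) (a = b)) (.count true x) [])
    (.count false x)
  rw [hf0] at h1
  refine (h1.seq (h2.seq (h3.seq h4))).of_eq ?_ ?_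
  · funext s
    rcases s with z | z | ⟨c, z⟩ | _ | _
    · simp [f, pushValue]
    · simp [f, pushValue]
    · cases c <;> by_cases hz : z = x <;> simp [f, hz, pushValue]
    all_goals simp [f, pushValue]
  · simp [f, pushValue]
    omega

theorem _root_.WordLogic.ncard_lt_and (m : ℕ) (p : ℕ → Prop) [DecidablePred p] :
    {x | x < m ∧ p x}.ncard = Nat.count p m := by
  rw [Nat.count_eq_card_filter_range, ← Set.ncard_coe_finset]
  congr 1
  ext x
  simp

/-- The bound variable takes the first free slot, which already stands at position 0 with empty
counters. Each quantifier multiplies the running time by about the length of the word, so a fixed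
nesting depth keeps it polynomial. -/
theorem countEq {P Q : List Letter → (Fin (n + 1) → ℕ) → Prop} (hP : Dec (n + 1) P)
    (hQ : Dec (n + 1) Q) : Dec n fun w v =>
      {x | x < w.length ∧ P w (Fin.cons x v)}.ncard =
        {x | x < w.length ∧ Q w (Fin.cons x v)}.ncard := by
  classical
  obtain ⟨m, hm⟩ := hP
  obtain ⟨m', hm'⟩ := hQ
  refine ⟨max m m' + 1, fun k hk => ?_⟩
  obtain ⟨c, p, hc⟩ := hm k (by omega)
  obtain ⟨d, q, hd⟩ := hm' k (by omega)
  have hn : n + 1 ≤ k := by omega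
  refine ⟨.seq (tally true (slot hn 0) c) (.seq (tally false (slot hn 0) d)
    (compare (slot hn 0))), .X * (p + 9) + .X * (q + 9) + 7 * .X + 9, fun w v S hv hS => ?_⟩
  set x := slot hn 0
  have hx : n ≤ x := by simp [x, val_slot_zero]
  have hv' : ∀ j < w.length, ∀ i, (Fin.cons j v : Fin (n + 1) → ℕ) i < w.length :=
    fun j hj => Fin.cases hj hv
  have hrep : Represents hn w (Fin.cons 0 v : Fin (n + 1) → ℕ) S := by
    constructor
    · exact Fin.cases (by simpa using hS.left_free _ hx) (fun i => by simpa using hS.left i)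
    · exact Fin.cases (by simpa using hS.right_free _ hx) (fun i => by simpa using hS.right i)
    · exact fun l hl => hS.left_free l (by omega)
    · exact fun l hl => hS.right_free l (by omega)
    · exact fun b l hl => hS.count_free b l (by omega)
    · exact hS.scratch
  have h1 := runsIn_tally hn true c w v S (fun j => P w (Fin.cons j v)) hrep
    (hS.count_free _ _ hx) (p.eval w.length) (fun j hj S' hS' => hc w _ S' (hv' j hj) hS')
  -- The second tally runs while the first count is still stored; this is harmless because slot `x`
  -- is now in use.
  have hrep' : Represents hn w (Fin.cons 0 v : Fin (n + 1) → ℕ) (update S (.count true x)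
      (List.replicate (Nat.count (fun j => P w (Fin.cons j v)) w.length) .system)) := by
    have hne : ∀ l : Fin k, n + 1 ≤ l → l ≠ x := by
      rintro l hl rfl
      simp only [x, val_slot_zero] at hl
      omega
    constructor
    · simpa using hrep.left
    · simpa using hrep.right
    · simpa using hrep.left_free
    · simpa using hrep.right_free
    · intro b l hl
      rw [update_of_ne (by simp [hne l hl])]
      exact hrep.count_free b l hl
    · simpa using hrep.scratch
  have h2 := runsIn_tally hn false d w v _ (fun j => Q w (Fin.cons j v)) hrep'
    (by simpa using hS.count_free _ _ hx) (q.eval w.length)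
    (fun j hj S' hS' => hd w _ S' (hv' j hj) hS')
  have h3 := runsIn_compare x _ _ _ w.length
    ((update_of_ne (by simp) _ (update S _ _)).trans (update_self _ _ _)) (update_self _ _ _)
    (Nat.count_le (fun j => P w (Fin.cons j v))) (Nat.count_le (fun j => Q w (Fin.cons j v)))
  refine (h1.seq (h2.seq h3)).of_eq ?_ ?_
  · simp only [ncard_lt_and]
    congr 1
    funext s
    have h4 := hS.count_free true x hx
    have h5 := hS.count_free false x hx
    rcases s with z | z | ⟨b, z⟩ | _ | _
    · simp
    · simp
    · cases b <;> by_cases hz : z = x <;> simp_all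
    all_goals simp
  · simp
    omega

/-! ### Decision procedures from closed formulas -/

/-- Execute `f l` for all `l < j`. -/
def forBelow {k : ℕ} (f : Fin k → Cmd (Stk k) Letter) : (j : ℕ) → j ≤ k → Cmd (Stk k) Letter
  | 0, _ => .skip
  | j + 1, h => .seq (forBelow f j (Nat.le_of_succ_le h)) (f ⟨j, h⟩)

theorem runsIn_forBelow {k : ℕ} (f : Fin k → Cmd (Stk k) Letter) (G : ℕ → Stk k → List Letter)
    (T : ℕ) (h : ∀ j (hj : j < k), RunsIn (f ⟨j, hj⟩) (G j) (G (j + 1)) T) :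
    RunsIn (forBelow f k le_rfl) (G 0) (G k) (k * T + 1) := by
  suffices H : ∀ j (hj : j ≤ k), RunsIn (forBelow f j hj) (G 0) (G j) (j * T + 1) from H k le_rfl
  intro j hj
  induction j with
  | zero => exact (Runs.skip _).runsIn.mono (by simp)
  | succ j ih => exact ((ih (by omega)).seq (h j hj)).mono (by rw [Nat.succ_mul]; omega)

/-- Move the positions of all slots to the start of the word. -/
def rewind {k : ℕ} (l : Fin k) : Cmd (Stk k) Letter :=
  .loop (.left l) (.left l) (fun o _ => o.isSome) (.move (.left l) (.right l))

theorem runsIn_rewind {k : ℕ} (l : Fin k) (S : Stk k → List Letter) (w : List Letter)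
    (h : S (.left l) = w.reverse) (h' : S (.right l) = []) :
    RunsIn (rewind l) S (update (update S (.left l) []) (.right l) w) (w.length * 3 + 1) := by
  let G : ℕ → Stk k → List Letter := fun i => update (update S (.left l)
    (w.take (w.length - i)).reverse) (.right l) (w.drop (w.length - i))
  have hG : G 0 = S := by
    simp only [G, Nat.sub_zero, List.take_length, List.drop_length]
    rw [← h, update_eq_self, ← h', update_eq_self]
  have := RunsIn.loop (k := Stk.left l) (k' := Stk.left l) (p := fun o _ => o.isSome)
    (c := .move (.left l) (.right l)) (T := 2) G w.length (fun i hi => ⟨?_, ?_⟩) (by simp [G])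
  · rw [hG] at this
    exact this.of_eq (by simp [G]) le_rfl
  · have : w ≠ [] := List.ne_nil_of_length_pos (by omega)
    simp [G, this]
    omega
  · obtain ⟨j, hj⟩ : ∃ j, w.length - i = j + 1 := ⟨w.length - i - 1, by omega⟩
    have hj' : w.length - (i + 1) = j := by omega
    obtain ⟨q, hq, hq'⟩ := exists_split (show j < w.length by omega)
    simp only [G, hj, hj']
    refine (RunsIn.move (a := q) (l := (w.take j).reverse) (by simp) ?_).of_eq ?_ le_rfl
    · simp [hq']
    · funext s
      rcases s with z | z | ⟨c, z⟩ | _ | _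
      · by_cases hz : z = l <;> simp [hz]
      · by_cases hz : z = l <;> simp [hz, hq]
      all_goals simp

/-- Make copies of the input word in all slots, evaluate a program and empty the slots. -/
def onCopies {k : ℕ} (c : Cmd (Stk k) Letter) : Cmd (Stk k) Letter :=
  .seq (.loop .scratch .scratch (fun o _ => o.isSome)
    (.seq (forBelow (fun l => .copy .scratch (.left l)) k le_rfl) (.pop .scratch))) <|
  .seq (forBelow rewind k le_rfl) <|
  .seq c (forBelow (fun l => .clear (.right l)) k le_rfl)

theorem runsIn_onCopies {k : ℕ} (c : Cmd (Stk k) Letter) (w : List Letter) (b : Bool) (T : ℕ)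
    (hc : ∀ S, Represents (Nat.zero_le k) w Fin.elim0 S → RunsIn c S (pushValue S b) T) :
    RunsIn (onCopies c) (update (fun _ => []) .scratch w)
      (update (fun _ => []) .value [.bit b])
      (T + w.length * (k + 3) + k * (w.length * 3 + 1) + k * (w.length * 2 + 1) + 3) := by
  -- The contents in the three phases: in `C i j`, `i` letters have been copied to all slots and the
  -- next one to the first `j` slots; in `W j` the first `j` slots have been rewound; in `Z j` they
  -- have been emptied.
  let C : ℕ → ℕ → Stk k → List Letter := fun i j s =>
    match s with
    | .left l => if (l : ℕ) < j then (w.take (i + 1)).reverse else (w.take i).reverse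
    | .scratch => w.drop i
    | _ => []
  let W : ℕ → Stk k → List Letter := fun j s =>
    match s with
    | .left l => if (l : ℕ) < j then [] else w.reverse
    | .right l => if (l : ℕ) < j then w else []
    | _ => []
  let Z : ℕ → Stk k → List Letter := fun j s =>
    match s with
    | .right l => if (l : ℕ) < j then [] else w
    | .value => [.bit b]
    | _ => []
  have hlt : ∀ (j : ℕ) (hj : j < k) (z : Fin k),
      ((z : ℕ) < j + 1 ↔ (z : ℕ) < j ∨ z = ⟨j, hj⟩) := by
    intro j hj z
    rw [Fin.ext_iff, Nat.lt_succ_iff_lt_or_eq]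
  have h1 : RunsIn (.loop .scratch .scratch (fun o _ => o.isSome)
      (.seq (forBelow (fun l => .copy .scratch (.left l)) k le_rfl) (.pop .scratch)))
      (C 0 0) (C w.length 0) (w.length * ((k * 1 + 1 + 1) + 1) + 1) := by
    refine RunsIn.loop (fun i => C i 0) w.length (fun i hi => ⟨?_, ?_⟩) (by simp [C])
    · simp [C]
      omega
    · refine ((runsIn_forBelow _ (C i) 1 fun j hj => ?_).seq (Runs.pop _ _).runsIn).of_eq ?_ le_rfl
      · refine (Runs.copy _ _ _).runsIn.of_eq ?_ le_rfl
        obtain ⟨q, hq, hq'⟩ := exists_split hi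
        funext s
        rcases s with z | z | ⟨c, z⟩ | _ | _
        · by_cases hz : z = ⟨j, hj⟩
          · simp [C, hz, hq, hq']
          · simp [C, hz, hlt j hj]
        all_goals simp [C]
      · funext s
        cases s <;> simp [C]
  have h2 : RunsIn (forBelow rewind k le_rfl) (W 0) (W k) (k * (w.length * 3 + 1) + 1) := by
    refine runsIn_forBelow _ W _ fun j hj => ?_
    refine (runsIn_rewind _ _ w ?_ ?_).of_eq ?_ le_rfl
    · simp [W]
    · simp [W]
    · funext s
      rcases s with z | z | ⟨c, z⟩ | _ | _
      · by_cases hz : z = ⟨j, hj⟩ <;> simp [W, hz, hlt j hj]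
      · by_cases hz : z = ⟨j, hj⟩ <;> simp [W, hz, hlt j hj]
      all_goals simp [W]
  have h3 : RunsIn c (W k) (pushValue (W k) b) T :=
    hc _ ⟨fun i => i.elim0, fun i => i.elim0, by simp [W], by simp [W], by simp [W], rfl⟩
  have h4 : RunsIn (forBelow (fun l => .clear (.right l)) k le_rfl) (Z 0) (Z k)
      (k * (w.length * 2 + 1) + 1) := by
    refine runsIn_forBelow _ Z _ fun j hj => ?_
    refine (RunsIn.clear _ _).of_eq ?_ (by simp [Z])
    funext s
    rcases s with z | z | ⟨c, z⟩ | _ | _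
    · simp [Z]
    · by_cases hz : z = ⟨j, hj⟩ <;> simp [Z, hz, hlt j hj]
    all_goals simp [Z]
  have e1 : C 0 0 = update (fun _ => []) .scratch w := by
    funext s
    cases s <;> simp [C]
  have e2 : C w.length 0 = W 0 := by
    funext s
    cases s <;> simp [C, W]
  have e3 : pushValue (W k) b = Z 0 := by
    funext s
    cases s <;> simp [pushValue, W, Z]
  have e4 : Z k = update (fun _ => []) .value [.bit b] := by
    funext s
    cases s <;> simp [Z]
  rw [e1, e2] at h1
  rw [e3] at h3
  rw [e4] at h4
  refine (h1.seq (h2.seq (h3.seq h4))).mono ?_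
  ring_nf
  omega

/-- Closed properties of words give decision problems in polynomial time. -/
theorem decidableInPolyTime {α : Type} {enc : α → List Letter} {P : List Letter → (Fin 0 → ℕ) → Prop}
    (hP : Dec 0 P) : DecidableInPolyTime enc fun a => P (enc a) Fin.elim0 := by
  classical
  obtain ⟨k, hk⟩ := hP
  obtain ⟨c, p, hc⟩ := hk k (by omega)
  refine decidableInPolyTime_of_runs (onCopies c) .scratch .value (fun a => a = .bit true)
    (p + .X * (k + 3) + k * (.X * 3 + 1) + k * (.X * 2 + 1) + 3) fun a =>
      ⟨.bit (decide (P (enc a) Fin.elim0)), by simp, ?_⟩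
  have := runsIn_onCopies c (enc a) (decide (P (enc a) Fin.elim0)) (p.eval (enc a).length)
    fun S hS => hc _ _ S (fun i => i.elim0) hS
  obtain ⟨t, ht, hr⟩ := this
  exact ⟨t, by simpa using ht, hr⟩

end Dec

end WordLogic

/-! ### Logics of positions of a list -/

namespace WordLogic

open Function

/-- A class of properties of lists and positions in them that is closed under the connectives of
first-order logic with counting and contains the order of positions. -/
structure IsLogic {α : Type} (D : ∀ n, (List α → (Fin n → ℕ) → Prop) → Prop) : Prop where
  congr {n : ℕ} {P Q : List α → (Fin n → ℕ) → Prop} :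
    (∀ l v, (∀ i, v i < l.length) → (P l v ↔ Q l v)) → D n P → D n Q
  not {n : ℕ} {P : List α → (Fin n → ℕ) → Prop} : D n P → D n fun l v => ¬ P l v
  and {n : ℕ} {P Q : List α → (Fin n → ℕ) → Prop} : D n P → D n Q → D n fun l v => P l v ∧ Q l v
  lt {n : ℕ} (i j : Fin n) : D n fun _ v => v i < v j
  countEq {n : ℕ} {P Q : List α → (Fin (n + 1) → ℕ) → Prop} : D (n + 1) P → D (n + 1) Q →
    D n fun l v => {x | x < l.length ∧ P l (Fin.cons x v)}.ncard =
      {x | x < l.length ∧ Q l (Fin.cons x v)}.ncard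

theorem Dec.isLogic : IsLogic Dec where
  congr := Dec.congr
  not := Dec.not
  and := Dec.and
  lt := Dec.lt
  countEq := Dec.countEq

namespace IsLogic

variable {α : Type} {D : ∀ n, (List α → (Fin n → ℕ) → Prop) → Prop} (hD : IsLogic D)
  {n : ℕ} {P Q : List α → (Fin n → ℕ) → Prop} {P' Q' : List α → (Fin n → ℕ) → ℕ → Prop}

include hD

theorem or (hP : D n P) (hQ : D n Q) : D n fun l v => P l v ∨ Q l v :=
  hD.congr (fun _ _ _ => by tauto) (hD.not (hD.and (hD.not hP) (hD.not hQ)))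

theorem imp (hP : D n P) (hQ : D n Q) : D n fun l v => P l v → Q l v :=
  hD.congr (fun _ _ _ => by tauto) (hD.not (hD.and hP (hD.not hQ)))

theorem iff (hP : D n P) (hQ : D n Q) : D n fun l v => P l v ↔ Q l v :=
  hD.congr (fun _ _ _ => by tauto) (hD.and (hD.imp hP hQ) (hD.imp hQ hP))

theorem le (i j : Fin n) : D n fun _ v => v i ≤ v j :=
  hD.congr (fun _ _ _ => by simp) (hD.not (hD.lt j i))

theorem ncardEq (hP : D (n + 1) fun l v => P' l (Fin.tail v) (v 0))
    (hQ : D (n + 1) fun l v => Q' l (Fin.tail v) (v 0)) :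
    D n fun l v => {x | x < l.length ∧ P' l v x}.ncard = {x | x < l.length ∧ Q' l v x}.ncard :=
  hD.congr (fun _ _ _ => by simp) (hD.countEq hP hQ)

/-- There is a witness exactly if the number of witnesses differs from that of an unsatisfiable
formula, for which x < x serves. -/
theorem ex (hP : D (n + 1) fun l v => P' l (Fin.tail v) (v 0)) :
    D n fun l v => ∃ x < l.length, P' l v x := by
  refine hD.congr (fun l v _ => ?_)
    (hD.not (hD.countEq hP (hD.congr (Q := fun _ _ => False) (by simp) (hD.lt 0 0))))
  have hfin : {x | x < l.length ∧ P' l v x}.Finite :=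
    (Set.finite_Iio l.length).subset fun x hx => hx.1
  simp [Set.ncard_eq_zero hfin, Set.eq_empty_iff_forall_notMem]

theorem all (hP : D (n + 1) fun l v => P' l (Fin.tail v) (v 0)) :
    D n fun l v => ∀ x < l.length, P' l v x :=
  hD.congr (fun _ _ _ => by simp) (hD.not (hD.ex (P' := fun l v x => ¬ P' l v x) (hD.not hP)))

end IsLogic

/-! ### Segments of a list -/

/-- The entries after position `x`, up to position `z`, do not start a segment. -/
def InSegment {α : Type} (start : α → Bool) (l : List α) (x z : ℕ) : Prop :=
  x < z ∧ ∀ u < l.length, x < u → u ≤ z → ¬ l[u]?.any start = true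

/-- The positions `z` and `u` have the same distance from the positions `x` and `y`. -/
def SameOffset {α : Type} (l : List α) (x z y u : ℕ) : Prop :=
  {k | k < l.length ∧ (x < k ∧ k ≤ z)}.ncard = {k | k < l.length ∧ (y < k ∧ k ≤ u)}.ncard

/-- A half-open interval from `a` to `b` contains `b - a` positions, with truncated subtraction if
`b < a`; this is how counting expresses distances. -/
theorem sameOffset_iff {α : Type} {l : List α} {x z y u : ℕ} (hz : z < l.length)
    (hu : u < l.length) : SameOffset l x z y u ↔ z - x = u - y := by
  have : ∀ a b, b < l.length → {k | k < l.length ∧ (a < k ∧ k ≤ b)}.ncard = b - a := by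
    intro a b hb
    rw [← Nat.card_Ioc, ← Set.ncard_coe_finset]
    congr 1
    ext k
    simp
    omega
  rw [SameOffset, this _ _ hz, this _ _ hu]

namespace IsLogic

variable {α : Type} {D : ∀ n, (List α → (Fin n → ℕ) → Prop) → Prop} (hD : IsLogic D) {n : ℕ}

include hD

theorem inSegment {start : α → Bool} (hs : ∀ n (i : Fin n), D n fun l v => l[v i]?.any start = true)
    (i j : Fin n) : D n fun l v => InSegment start l (v i) (v j) :=
  hD.and (hD.lt i j) (hD.all (P' := fun l v u => v i < u → u ≤ v j → ¬ l[u]?.any start = true)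
    (hD.imp (hD.lt i.succ 0) (hD.imp (hD.le 0 j.succ) (hD.not (hs _ 0)))))

theorem sameOffset (i j i' j' : Fin n) :
    D n fun l v => SameOffset l (v i) (v j) (v i') (v j') :=
  hD.ncardEq (P' := fun _ v k => v i < k ∧ k ≤ v j) (Q' := fun _ v k => v i' < k ∧ k ≤ v j')
    (hD.and (hD.lt i.succ 0) (hD.le 0 j.succ)) (hD.and (hD.lt i'.succ 0) (hD.le 0 j'.succ))

end IsLogic

/-! ### Lists that are encoded by lists -/

/-- `enc` encodes each entry by a list that consists of a start symbol and of other symbols. -/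
def IsSegmentCode {α β : Type} (start : α → Bool) (enc : β → List α) : Prop :=
  ∀ b, ∃ a l, enc b = a :: l ∧ start a = true ∧ ∀ a' ∈ l, start a' = false

/-- The position in the code of `l` at which the code of the `i`-th entry begins. -/
def codePos {α β : Type} (enc : β → List α) (l : List β) (i : ℕ) : ℕ :=
  ((l.take i).flatMap enc).length

/-- The properties of lists that are properties of their codes. -/
def Encoded {α β : Type} (D : ∀ n, (List α → (Fin n → ℕ) → Prop) → Prop) (enc : β → List α) (n : ℕ)
    (P : List β → (Fin n → ℕ) → Prop) : Prop :=
  ∃ Q, D n Q ∧ ∀ l v, (∀ i, v i < l.length) →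
    (Q (l.flatMap enc) (fun i => codePos enc l (v i)) ↔ P l v)

section Code

variable {α β : Type} {start : α → Bool} {enc : β → List α} {l : List β} {n : ℕ}

theorem drop_codePos {i : ℕ} (hi : i < l.length) :
    (l.flatMap enc).drop (codePos enc l i) = enc l[i] ++ (l.drop (i + 1)).flatMap enc := by
  have : l.flatMap enc = (l.take i).flatMap enc ++ (l.drop i).flatMap enc := by
    rw [← List.flatMap_append, List.take_append_drop]
  rw [this, codePos, List.drop_left, List.drop_eq_getElem_cons hi, List.flatMap_cons]

theorem codePos_succ {i : ℕ} (hi : i < l.length) :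
    codePos enc l (i + 1) = codePos enc l i + (enc l[i]).length := by
  simp [codePos, List.take_succ_eq_append_getElem hi, -List.take_append_getElem]

theorem IsSegmentCode.codePos_lt (h : IsSegmentCode start enc) {i j : ℕ} (hij : i < j)
    (hj : j ≤ l.length) : codePos enc l i < codePos enc l j := by
  induction j, hij using Nat.le_induction with
  | base =>
    obtain ⟨a, t, ht, -⟩ := h l[i]
    rw [codePos_succ (by omega), ht]
    simp
  | succ j hij ih =>
    rw [codePos_succ (by omega)]
    have := ih (by omega)
    omega

theorem IsSegmentCode.codePos_lt_iff (h : IsSegmentCode start enc) {i j : ℕ}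
    (hi : i ≤ l.length) (hj : j ≤ l.length) : codePos enc l i < codePos enc l j ↔ i < j := by
  refine ⟨fun hlt => ?_, fun hij => h.codePos_lt hij hj⟩
  by_contra hij
  obtain rfl | hji := (Nat.le_of_not_lt hij).eq_or_lt
  · exact lt_irrefl _ hlt
  · exact lt_asymm hlt (h.codePos_lt hji hi)

theorem codePos_length : codePos enc l l.length = (l.flatMap enc).length := by simp [codePos]

theorem IsSegmentCode.codePos_lt_length (h : IsSegmentCode start enc) {i : ℕ} (hi : i < l.length) :
    codePos enc l i < (l.flatMap enc).length := by
  rw [← codePos_length]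
  exact h.codePos_lt hi le_rfl

theorem IsSegmentCode.head?_drop (h : IsSegmentCode start enc) {i : ℕ} (hi : i < l.length) :
    (l.flatMap enc)[codePos enc l i]? = (enc l[i]).head? := by
  rw [← List.head?_drop, drop_codePos hi]
  obtain ⟨a, t, ht, -⟩ := h l[i]
  simp [ht]

/-- Each code has its only start symbol in front, so the start symbols of the whole list mark
exactly the beginnings of the codes. -/
theorem IsSegmentCode.any_start_iff (h : IsSegmentCode start enc) {x : ℕ} :
    (l.flatMap enc)[x]?.any start = true ↔ ∃ i < l.length, x = codePos enc l i := by
  constructor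
  · intro hx
    induction l generalizing x with
    | nil => simp at hx
    | cons b l ih =>
      obtain ⟨a, t, ht, -, hta⟩ := h b
      rw [List.flatMap_cons] at hx
      by_cases hlt : x < (enc b).length
      · rw [List.getElem?_append_left hlt, ht] at hx
        rcases x with _ | x
        · exact ⟨0, by simp, by simp [codePos]⟩
        · rw [List.getElem?_cons_succ] at hx
          rw [ht] at hlt
          rw [List.getElem?_eq_getElem (by simpa using hlt)] at hx
          have := hta _ (List.getElem_mem (by simpa using hlt))
          simp_all
      · rw [List.getElem?_append_right (by omega)] at hx
        obtain ⟨i, hi, hxi⟩ := ih hx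
        refine ⟨i + 1, by simpa using hi, ?_⟩
        simp only [codePos, List.take_succ_cons, List.flatMap_cons, List.length_append] at hxi ⊢
        omega
  · rintro ⟨i, hi, rfl⟩
    rw [h.head?_drop hi]
    obtain ⟨a, t, ht, ha, -⟩ := h l[i]
    simp [ht, ha]

variable {D : ∀ n, (List α → (Fin n → ℕ) → Prop) → Prop} (hD : IsLogic D)
  (hs : ∀ n (i : Fin n), D n fun l v => l[v i]?.any start = true) (h : IsSegmentCode start enc)

-- Counting is relativised to start symbols. As `codePos` is an increasing bijection from the
-- entries onto their positions, order and cardinalities are the same in the list and in its code.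
include hD hs h in
theorem Encoded.isLogic : IsLogic (Encoded D enc) where
  congr := by
    rintro n P Q hPQ ⟨P', hP', hP⟩
    exact ⟨P', hP', fun l v hv => (hP l v hv).trans (hPQ l v hv)⟩
  not := by
    rintro n P ⟨P', hP', hP⟩
    exact ⟨_, hD.not hP', fun l v hv => not_congr (hP l v hv)⟩
  and := by
    rintro n P Q ⟨P', hP', hP⟩ ⟨Q', hQ', hQ⟩
    exact ⟨_, hD.and hP' hQ', fun l v hv => and_congr (hP l v hv) (hQ l v hv)⟩
  lt i j := ⟨_, hD.lt i j, fun l v hv => h.codePos_lt_iff (hv i).le (hv j).le⟩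
  countEq := by
    rintro n P Q ⟨P', hP', hP⟩ ⟨Q', hQ', hQ⟩
    refine ⟨_, hD.countEq (hD.and (hs _ 0) hP') (hD.and (hs _ 0) hQ'), fun l v hv => ?_⟩
    suffices H : ∀ (P : List β → (Fin (n + 1) → ℕ) → Prop)
        (P' : List α → (Fin (n + 1) → ℕ) → Prop),
        (∀ l v, (∀ i, v i < l.length) →
          (P' (l.flatMap enc) (fun i => codePos enc l (v i)) ↔ P l v)) →
        {x | x < (l.flatMap enc).length ∧ ((l.flatMap enc)[x]?.any start = true ∧
          P' (l.flatMap enc) (Fin.cons x fun i => codePos enc l (v i)))}.ncard =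
        {x | x < l.length ∧ P l (Fin.cons x v)}.ncard by
      simp only [Fin.cons_zero]
      rw [H P P' hP, H Q Q' hQ]
    clear hP hQ
    intro P P' hP
    have hcons : ∀ x, (Fin.cons (codePos enc l x) fun i => codePos enc l (v i) : Fin (n + 1) → ℕ) =
        fun i => codePos enc l ((Fin.cons x v : Fin (n + 1) → ℕ) i) := by
      intro x
      funext i
      cases i using Fin.cases <;> simp
    have hP : ∀ x < l.length, P' (l.flatMap enc)
        (Fin.cons (codePos enc l x) fun i => codePos enc l (v i)) ↔ P l (Fin.cons x v) := by
      intro x hx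
      rw [hcons]
      exact hP l _ (Fin.cases hx hv)
    refine Eq.trans ?_ (Set.InjOn.ncard_image (f := codePos enc l) ?_)
    · congr 1
      ext x
      simp only [h.any_start_iff, Set.mem_ofPred_eq, Set.mem_image]
      constructor
      · rintro ⟨-, ⟨i, hi, rfl⟩, hx⟩
        exact ⟨i, ⟨hi, (hP i hi).1 hx⟩, rfl⟩
      · rintro ⟨i, ⟨hi, hx⟩, rfl⟩
        exact ⟨h.codePos_lt_length hi, ⟨i, hi, rfl⟩, (hP i hi).2 hx⟩
    · intro i hi j hj hij
      by_contra hne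
      rcases Nat.lt_or_gt_of_ne hne with hlt | hlt
      · exact (h.codePos_lt hlt hj.1.le).ne hij
      · exact (h.codePos_lt hlt hi.1.le).ne hij.symm

include h in
theorem Encoded.head {q : α → Bool} {i : Fin n}
    (hq : D n fun l v => l[v i]?.any q = true) :
    Encoded D enc n fun l v => l[v i]?.any (fun b => (enc b).head?.any q) = true := by
  refine ⟨_, hq, fun l v hv => ?_⟩
  beta_reduce
  rw [h.head?_drop (hv i), List.getElem?_eq_getElem (hv i)]
  simp

theorem getElem?_codePos {i j : ℕ} (hi : i < l.length) (hj : j < (enc l[i]).tail.length) :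
    (l.flatMap enc)[codePos enc l i + 1 + j]? = (enc l[i]).tail[j]? := by
  rw [Nat.add_assoc, ← List.getElem?_drop, drop_codePos hi, List.getElem?_append_left]
  · simp [Nat.add_comm]
  · simp at hj
    omega

-- The first start symbol after the beginning of entry `i` belongs to entry `i + 1`; if there is no
-- such entry, the whole list ends with the code of entry `i`.
include h in
theorem IsSegmentCode.inSegment_iff {i z : ℕ} (hi : i < l.length) (hz : z < (l.flatMap enc).length) :
    InSegment start (l.flatMap enc) (codePos enc l i) z ↔
      ∃ j < (enc l[i]).tail.length, z = codePos enc l i + 1 + j := by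
  have hsucc := codePos_succ (enc := enc) hi
  have hpos : (enc l[i]).length = (enc l[i]).tail.length + 1 := by
    obtain ⟨a, t, ht, -⟩ := h l[i]
    simp [ht]
  constructor
  · rintro ⟨hlt, hseg⟩
    have hz' : z < codePos enc l (i + 1) := by
      by_contra hle
      rw [Nat.not_lt] at hle
      rcases Nat.lt_or_ge (i + 1) l.length with hi' | hi'
      · exact hseg _ (h.codePos_lt_length hi') (by omega) hle
          (h.any_start_iff.2 ⟨_, hi', rfl⟩)
      · rw [show i + 1 = l.length by omega, codePos_length] at hle
        omega
    exact ⟨z - (codePos enc l i + 1), by omega, by omega⟩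
  · rintro ⟨j, hj, rfl⟩
    refine ⟨by omega, fun u hu hlt hle hstart => ?_⟩
    obtain ⟨i', hi', rfl⟩ := h.any_start_iff.1 hstart
    rw [h.codePos_lt_iff hi.le hi'.le] at hlt
    have : codePos enc l i' < codePos enc l (i + 1) := by omega
    rw [h.codePos_lt_iff hi'.le (by omega)] at this
    omega

include h in
theorem IsSegmentCode.ncard_inSegment {i : ℕ} (hi : i < l.length) (p : ℕ → Prop) :
    {z | z < (l.flatMap enc).length ∧ (InSegment start (l.flatMap enc) (codePos enc l i) z ∧ p z)}.ncard =
      {j | j < (enc l[i]).tail.length ∧ p (codePos enc l i + 1 + j)}.ncard := by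
  refine Eq.trans ?_ (Set.ncard_image_of_injective _ (f := fun j => codePos enc l i + 1 + j)
    (fun a b hab => by simpa using hab))
  congr 1
  ext z
  simp only [Set.mem_ofPred_eq, Set.mem_image]
  constructor
  · rintro ⟨hz, hseg, hp⟩
    obtain ⟨j, hj, rfl⟩ := (h.inSegment_iff hi hz).1 hseg
    exact ⟨j, ⟨hj, hp⟩, rfl⟩
  · rintro ⟨j, ⟨hj, hp⟩, rfl⟩
    have hz : codePos enc l i + 1 + j < (l.flatMap enc).length := by
      have := getElem?_codePos hi hj
      rw [List.getElem?_eq_getElem hj] at this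
      exact (List.getElem?_eq_some_iff.1 this).1
    exact ⟨hz, (h.inSegment_iff hi hz).2 ⟨j, hj, rfl⟩, hp⟩

end Code

/-! ### Comparison of two segments by counting formulas -/

theorem ncard_getElem?_eq {γ : Type} [DecidableEq γ] (s : List γ) (c : γ) :
    {j | j < s.length ∧ s[j]? = some c}.ncard = s.count c := by
  rw [ncard_lt_and]
  induction s with
  | nil => simp
  | cons a s ih =>
    rw [List.length_cons, Nat.count_succ', List.count_cons]
    simp only [List.getElem?_cons_succ, List.getElem?_cons_zero, Option.some.injEq, ih, beq_iff_eq]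

/-- The entries at two positions are related. -/
def AtPair {β : Type} (R : β → β → Prop) (l : List β) (x y : ℕ) : Prop :=
  ∀ b ∈ l[x]?, ∀ b' ∈ l[y]?, R b b'

/-- Two lists have the same length and pattern: corresponding entries have the same image under
`f`, and two entries of one list are equal if and only if the corresponding entries of the other
list are equal. -/
def SamePattern {α γ : Type} (f : α → γ) (s t : List α) : Prop :=
  s.length = t.length ∧ ∀ a < s.length, ∀ b < s.length,
    s[a]?.map f = t[a]?.map f ∧ (s[a]? = s[b]? ↔ t[a]? = t[b]?)

section Segments

variable {α β γ : Type} {start : α → Bool} {enc : β → List α} {l : List β}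
  {D : ∀ n, (List α → (Fin n → ℕ) → Prop) → Prop} {n : ℕ} {f : α → γ}

/-- Equality of the numbers of occurrences of all symbols in two segments. -/
theorem Encoded.perm (hD : IsLogic D)
    (hs : ∀ n (i : Fin n), D n fun l v => l[v i]?.any start = true) (h : IsSegmentCode start enc)
    (hf : ∀ n (i j : Fin n), i ≠ j → D n fun l v => l[v i]?.map f = l[v j]?.map f) (i j : Fin n) :
    Encoded D enc n fun l v =>
      AtPair (fun b b' => ((enc b).tail.map f).Perm ((enc b').tail.map f)) l (v i) (v j) := by
  classical
  -- Variables range over positions, so a position `t` of the whole list stands for its image under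
  -- `f`. An image that occurs nowhere has multiplicity zero in both segments.
  refine ⟨_, hD.all (P' := fun (w : List α) v t =>
    {z | z < w.length ∧ (InSegment start w (v i) z ∧ w[t]?.map f = w[z]?.map f)}.ncard =
    {z | z < w.length ∧ (InSegment start w (v j) z ∧ w[t]?.map f = w[z]?.map f)}.ncard)
    (hD.ncardEq
      (P' := fun (w : List α) v z => InSegment start w (v i.succ) z ∧ w[v 0]?.map f = w[z]?.map f)
      (Q' := fun (w : List α) v z => InSegment start w (v j.succ) z ∧ w[v 0]?.map f = w[z]?.map f)
      (hD.and (hD.inSegment hs i.succ.succ 0) (hf _ 1 0 (by simp)))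
      (hD.and (hD.inSegment hs j.succ.succ 0) (hf _ 1 0 (by simp)))), fun l v hv => ?_⟩
  have key : ∀ (i : Fin n) (t : ℕ) (c : γ), (l.flatMap enc)[t]?.map f = some c →
      {z | z < (l.flatMap enc).length ∧ (InSegment start (l.flatMap enc) (codePos enc l (v i)) z ∧
        (l.flatMap enc)[t]?.map f = (l.flatMap enc)[z]?.map f)}.ncard =
      ((enc (l[v i]'(hv i))).tail.map f).count c := by
    intro i t c hc
    rw [h.ncard_inSegment (hv i), ← ncard_getElem?_eq, hc]
    congr 1
    ext k
    simp only [Set.mem_ofPred_eq, List.length_map, and_congr_right_iff]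
    intro hk
    rw [getElem?_codePos (hv i) hk, List.getElem?_map, eq_comm]
  have hmem : ∀ i : Fin n, ∀ c ∈ (enc (l[v i]'(hv i))).tail.map f,
      ∃ t < (l.flatMap enc).length, (l.flatMap enc)[t]?.map f = some c := by
    intro i c hc
    obtain ⟨a, ha, rfl⟩ := List.mem_map.1 hc
    have : a ∈ l.flatMap enc :=
      List.mem_flatMap.2 ⟨_, List.getElem_mem (hv i), List.mem_of_mem_tail ha⟩
    obtain ⟨t, ht, rfl⟩ := List.getElem_of_mem this
    exact ⟨t, ht, by rw [List.getElem?_eq_getElem ht]; rfl⟩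
  simp only [AtPair, List.getElem?_eq_getElem (hv i), List.getElem?_eq_getElem (hv j),
    Option.mem_def, Option.some.injEq, forall_eq']
  rw [List.perm_iff_count]
  constructor
  · intro H c
    by_cases hc : ∃ t < (l.flatMap enc).length, (l.flatMap enc)[t]?.map f = some c
    · obtain ⟨t, ht, hc⟩ := hc
      have := H t ht
      rwa [key i t c hc, key j t c hc] at this
    · rw [List.count_eq_zero_of_not_mem (fun h => hc (hmem i c h)),
        List.count_eq_zero_of_not_mem (fun h => hc (hmem j c h))]
  · intro H t ht
    have hc : (l.flatMap enc)[t]?.map f = some (f (l.flatMap enc)[t]) := by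
      rw [List.getElem?_eq_getElem ht]
      rfl
    rw [key i t _ hc, key j t _ hc, H]

/-- Entries of the two segments correspond if they have the same distance from the beginnings of
their segments. The formula compares two corresponding pairs, `z` with `u` and `z'` with `u'`. -/
theorem Encoded.samePattern (hD : IsLogic D)
    (hs : ∀ n (i : Fin n), D n fun l v => l[v i]?.any start = true) (h : IsSegmentCode start enc)
    (hf : ∀ n (i j : Fin n), i ≠ j → D n fun l v => l[v i]?.map f = l[v j]?.map f)
    (heq : ∀ n (i j : Fin n), i ≠ j → D n fun l v => l[v i]? = l[v j]?) (i j : Fin n) :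
    Encoded D enc n fun l v =>
      AtPair (fun b b' => SamePattern f (enc b).tail (enc b').tail) l (v i) (v j) := by
  -- The conjuncts `v i < z` and `v j < z` follow from `InSegment`; they only fill the place of the
  -- predicate in `ncard_inSegment`.
  refine ⟨fun (w : List α) v =>
    {z | z < w.length ∧ (InSegment start w (v i) z ∧ v i < z)}.ncard =
      {z | z < w.length ∧ (InSegment start w (v j) z ∧ v j < z)}.ncard ∧
    ∀ z < w.length, ∀ u < w.length, ∀ z' < w.length, ∀ u' < w.length,
      (InSegment start w (v i) z ∧ InSegment start w (v j) u ∧ SameOffset w (v i) z (v j) u) →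
      (InSegment start w (v i) z' ∧ InSegment start w (v j) u' ∧ SameOffset w (v i) z' (v j) u') →
      (w[z]?.map f = w[u]?.map f ∧ (w[z]? = w[z']? ↔ w[u]? = w[u']?)), ?_, fun l v hv => ?_⟩
  · refine hD.and (hD.ncardEq (P' := fun w v z => InSegment start w (v i) z ∧ v i < z)
      (Q' := fun w v z => InSegment start w (v j) z ∧ v j < z)
      (hD.and (hD.inSegment hs i.succ 0) (hD.lt i.succ 0))
      (hD.and (hD.inSegment hs j.succ 0) (hD.lt j.succ 0))) ?_
    refine hD.all (P' := fun (w : List α) v z => ∀ u < w.length, ∀ z' < w.length, ∀ u' < w.length,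
      (InSegment start w (v i) z ∧ InSegment start w (v j) u ∧ SameOffset w (v i) z (v j) u) →
      (InSegment start w (v i) z' ∧ InSegment start w (v j) u' ∧ SameOffset w (v i) z' (v j) u') →
      (w[z]?.map f = w[u]?.map f ∧ (w[z]? = w[z']? ↔ w[u]? = w[u']?))) ?_
    refine hD.all ?_
    refine hD.all ?_
    refine hD.all ?_
    -- The variable bound last has index 0, and each quantifier shifts the earlier variables by one.
    let z : Fin (n + 1 + 1 + 1 + 1) := Fin.succ (Fin.succ (Fin.succ 0))
    let u : Fin (n + 1 + 1 + 1 + 1) := Fin.succ (Fin.succ 0)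
    let z' : Fin (n + 1 + 1 + 1 + 1) := Fin.succ 0
    let u' : Fin (n + 1 + 1 + 1 + 1) := 0
    have hne : z ≠ u ∧ z ≠ z' ∧ u ≠ u' := by
      simp only [ne_eq, z, u, z', u', Fin.ext_iff, Fin.val_succ, Fin.val_zero]
      omega
    exact hD.imp (hD.and (hD.inSegment hs i.succ.succ.succ.succ z)
        (hD.and (hD.inSegment hs j.succ.succ.succ.succ u)
          (hD.sameOffset i.succ.succ.succ.succ z j.succ.succ.succ.succ u)))
      (hD.imp (hD.and (hD.inSegment hs i.succ.succ.succ.succ z')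
        (hD.and (hD.inSegment hs j.succ.succ.succ.succ u')
          (hD.sameOffset i.succ.succ.succ.succ z' j.succ.succ.succ.succ u')))
        (hD.and (hf _ z u hne.1) (hD.iff (heq _ z z' hne.2.1) (heq _ u u' hne.2.2))))
  · have hlen : ∀ i : Fin n, {z | z < (l.flatMap enc).length ∧
        (InSegment start (l.flatMap enc) (codePos enc l (v i)) z ∧ codePos enc l (v i) < z)}.ncard =
        (enc (l[v i]'(hv i))).tail.length := by
      intro i
      rw [h.ncard_inSegment (hv i)]
      refine Eq.trans ?_ (Nat.card_Iio _)
      rw [← Set.ncard_coe_finset]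
      congr 1
      ext k
      simp
      omega
    have hmem : ∀ i : Fin n, ∀ k < (enc (l[v i]'(hv i))).tail.length,
        codePos enc l (v i) + 1 + k < (l.flatMap enc).length := by
      intro i k hk
      have := getElem?_codePos (hv i) hk
      rw [List.getElem?_eq_getElem hk] at this
      exact (List.getElem?_eq_some_iff.1 this).1
    simp only [AtPair, List.getElem?_eq_getElem (hv i), List.getElem?_eq_getElem (hv j),
      Option.mem_def, Option.some.injEq, forall_eq', hlen, SamePattern]
    refine and_congr_right fun hl => ⟨fun H a ha b hb => ?_, fun H z hz u hu z' hz' u' hu' => ?_⟩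
    · have hseg : ∀ i : Fin n, ∀ k < (enc (l[v i]'(hv i))).tail.length,
          InSegment start (l.flatMap enc) (codePos enc l (v i)) (codePos enc l (v i) + 1 + k) :=
        fun i k hk => (h.inSegment_iff (hv i) (hmem i k hk)).2 ⟨k, hk, rfl⟩
      have := H _ (hmem i a ha) _ (hmem j a (hl ▸ ha)) _ (hmem i b hb) _ (hmem j b (hl ▸ hb))
        ⟨hseg i a ha, hseg j a (hl ▸ ha),
          (sameOffset_iff (hmem i a ha) (hmem j a (hl ▸ ha))).2 (by omega)⟩
        ⟨hseg i b hb, hseg j b (hl ▸ hb),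
          (sameOffset_iff (hmem i b hb) (hmem j b (hl ▸ hb))).2 (by omega)⟩
      rwa [getElem?_codePos (hv i) ha, getElem?_codePos (hv i) hb,
        getElem?_codePos (hv j) (hl ▸ ha), getElem?_codePos (hv j) (hl ▸ hb)] at this
    · rintro ⟨h1, h2, h3⟩ ⟨h1', h2', h3'⟩
      rw [sameOffset_iff hz hu] at h3
      rw [sameOffset_iff hz' hu'] at h3'
      obtain ⟨a, ha, rfl⟩ := (h.inSegment_iff (hv i) hz).1 h1
      obtain ⟨a', ha', rfl⟩ := (h.inSegment_iff (hv j) hu).1 h2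
      obtain ⟨b, hb, rfl⟩ := (h.inSegment_iff (hv i) hz').1 h1'
      obtain ⟨b', hb', rfl⟩ := (h.inSegment_iff (hv j) hu').1 h2'
      obtain rfl : a = a' := by omega
      obtain rfl : b = b' := by omega
      rw [getElem?_codePos (hv i) ha, getElem?_codePos (hv i) hb, getElem?_codePos (hv j) ha',
        getElem?_codePos (hv j) hb']
      exact H a ha b hb

end Segments

end WordLogic

/-! ### Extension of partial bijections that preserve colours -/

/-- Without prescribed pairs, bijections of the colour classes are glued together. Prescribed pairs
are then enforced one at a time by transpositions within a colour class. -/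
theorem exists_equiv_extending {A B C : Type} [Finite A] [Finite B] (cA : A → C) (cB : B → C)
    (h : ∀ c, {a | cA a = c}.ncard = {b | cB b = c}.ncard) (R : Set (A × B))
    (hc : ∀ p ∈ R, cA p.1 = cB p.2) (hR : ∀ p ∈ R, ∀ q ∈ R, p.1 = q.1 ↔ p.2 = q.2) :
    ∃ e : A ≃ B, (∀ a, cB (e a) = cA a) ∧ ∀ p ∈ R, e p.1 = p.2 := by
  classical
  have hfin : R.Finite := Set.toFinite R
  induction R, hfin using Set.Finite.induction_on with
  | empty =>
    have hfib : ∀ c, Nonempty ({a // cA a = c} ≃ {b // cB b = c}) := fun c =>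
      Finite.card_eq.1 (h c)
    let e : A ≃ B := (Equiv.sigmaFiberEquiv cA).symm.trans
      ((Equiv.sigmaCongrRight fun c => (hfib c).some).trans (Equiv.sigmaFiberEquiv cB))
    exact ⟨e, fun a => ((hfib (cA a)).some ⟨a, rfl⟩).2, by simp⟩
  | @insert p R hp _ ih =>
    obtain ⟨e, he, heR⟩ := ih (fun q hq => hc q (Or.inr hq))
      (fun q hq r hr => hR q (Or.inr hq) r (Or.inr hr))
    -- `e p.1` and `p.2` have the same colour. The pairs enforced before survive: for such a pair
    -- with `q.2 ≠ p.2`, neither of the swapped elements is `q.2`.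
    refine ⟨e.trans (Equiv.swap (e p.1) p.2), fun a => ?_, ?_⟩
    · have hp' : cB (e p.1) = cB p.2 := by rw [he, hc p (Or.inl rfl)]
      rw [Equiv.trans_apply, ← he a, Equiv.swap_apply_def]
      split_ifs with h1 h2
      · rw [h1, hp']
      · rw [h2, hp']
      · rfl
    · rintro q (rfl | hq)
      · simp
      · rw [Equiv.trans_apply, heR q hq]
        have hpq := hR p (Or.inl rfl) q (Or.inr hq)
        by_cases hne : p.2 = q.2
        · have : p.1 = q.1 := hpq.2 hne
          rw [this, heR q hq, hne, Equiv.swap_self]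
          rfl
        · refine Equiv.swap_apply_of_ne_of_ne (fun h => hne (hpq.1 ?_)) (Ne.symm hne)
          rw [← heR q hq] at h
          exact (e.injective h).symm

theorem List.Nodup.count_map_of_forall_mem {A C : Type} [DecidableEq C] {L : List A} (h : L.Nodup)
    (hL : ∀ a, a ∈ L) (c : A → C) (d : C) : (L.map c).count d = {a | c a = d}.ncard := by
  classical
  rw [List.count, List.countP_map, List.countP_eq_length_filter,
    ← List.toFinset_card_of_nodup (h.filter _), ← Set.ncard_coe_finset]
  congr 1
  ext a
  simp [hL]

namespace TermRewriting

open WordLogic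

/-! ### Symbol sequences of terms and rules -/

/-- The symbols of rules, with their names and arities. -/
inductive Token : Type
  | arrow
  | function (name arity : ℕ)
  | variable (name : ℕ)

/-- Forget the names of function symbols unless `kf` holds, and of variables unless `kv` holds. -/
def Token.forget (kf kv : Bool) : Token → Token
  | .arrow => .arrow
  | .function n a => .function (bif kf then n else 0) a
  | .variable n => .variable (bif kv then n else 0)

/-- Invariance under renaming for the kinds of symbols whose names matter. -/
def TermIso.Respects {S T : Signature} (kf kv : Bool) (φ : TermIso S T) : Prop :=
  (kf = true → φ.FunInvariant) ∧ (kv = true → φ.VarInvariant)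

variable {S T : Signature}

/-- A symbol of a signature as a token. -/
def symbolToken : S.funs ⊕ S.vars → Token
  | .inl f => .function f (S.arity f)
  | .inr x => .variable x

theorem symbolToken_injective : Function.Injective (symbolToken (S := S)) := by
  rintro (f | x) (g | y) h
  · simp only [symbolToken, Token.function.injEq] at h
    exact congrArg _ (Subtype.ext h.1)
  · cases h
  · cases h
  · simp only [symbolToken, Token.variable.injEq] at h
    exact congrArg _ (Subtype.ext h)

/-- The symbols of a term in prefix notation. -/
def Term.symbols : Term S → List (S.funs ⊕ S.vars)
  | .var x => [.inr x]
  | .app f ts => .inl f :: (List.ofFn fun i => (ts i).symbols).flatten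

/-- Unique readability of prefix notation: the head symbol fixes the number of arguments. The
arbitrary remainders `l`, `l'` make the induction work, since each argument is followed by the later
ones. -/
theorem Term.symbols_append_inj (t : Term S) : ∀ (t' : Term S) (l l' : List (S.funs ⊕ S.vars)),
    t.symbols ++ l = t'.symbols ++ l' → t = t' ∧ l = l' := by
  induction t with
  | var x =>
    intro t' l l' h
    cases t' with
    | var y => simpa [symbols] using h
    | app g us => simp [symbols] at h
  | app f ts ih =>
    intro t' l l' h
    cases t' with
    | var y => simp [symbols] at h
    | app g us =>
      simp only [symbols, List.cons_append, List.cons.injEq, Sum.inl.injEq] at h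
      obtain ⟨rfl, h⟩ := h
      suffices H : ∀ (n : ℕ) (ts us : Fin n → Term S) (_ : ∀ i (t' : Term S) l l',
          (ts i).symbols ++ l = t'.symbols ++ l' → ts i = t' ∧ l = l'),
          (List.ofFn fun i => (ts i).symbols).flatten ++ l =
            (List.ofFn fun i => (us i).symbols).flatten ++ l' → ts = us ∧ l = l' by
        obtain ⟨rfl, rfl⟩ := H _ ts us ih h
        exact ⟨rfl, rfl⟩
      clear ih h ts us
      intro n
      induction n with
      | zero =>
        intro ts us _ h
        exact ⟨Subsingleton.elim _ _, by simpa using h⟩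
      | succ n ihn =>
        intro ts us ih h
        simp only [List.ofFn_succ, List.flatten_cons, List.append_assoc] at h
        obtain ⟨h0, h⟩ := ih 0 _ _ _ h
        obtain ⟨h1, h⟩ := ihn (fun i => ts i.succ) (fun i => us i.succ) (fun i => ih i.succ) h
        refine ⟨?_, h⟩
        funext i
        cases i using Fin.cases with
        | zero => exact h0
        | succ i => exact congrFun h1 i

/-- The action of a term isomorphism on symbols. -/
def TermIso.onSymbol (φ : TermIso S T) : S.funs ⊕ S.vars → T.funs ⊕ T.vars :=
  Sum.map φ.onFun φ.onVar

theorem TermIso.onSymbol_injective (φ : TermIso S T) : Function.Injective φ.onSymbol :=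
  φ.onFun.injective.sumMap φ.onVar.injective

theorem TermIso.symbols_mapTerm (φ : TermIso S T) (t : Term S) :
    (φ.mapTerm t).symbols = t.symbols.map φ.onSymbol := by
  induction t with
  | var x => rfl
  | app f ts ih =>
    simp only [mapTerm, Term.symbols, List.map_cons, List.map_flatten, List.map_ofFn, ih]
    congr 2
    exact (List.ofFn_congr (φ.arity_eq f) (fun i => (ts i).symbols.map φ.onSymbol)).symm

/-- The symbols of a rule; `none` separates the two sides. -/
def Rule.symbols (ρ : Rule S) : List (Option (S.funs ⊕ S.vars)) :=
  ρ.lhs.symbols.map some ++ none :: ρ.rhs.symbols.map some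

/-- `none` occurs in neither side, so its position determines where the left-hand side ends. -/
theorem Rule.symbols_injective : Function.Injective (Rule.symbols (S := S)) := by
  rintro ⟨l, r⟩ ⟨l', r'⟩ h
  simp only [symbols] at h
  have h1 : l.symbols ++ [] = l'.symbols ++ [] ∧ r.symbols ++ [] = r'.symbols ++ [] := by
    generalize l.symbols = a at h ⊢
    generalize l'.symbols = a' at h ⊢
    induction a generalizing a' with
    | nil => cases a' <;> simp_all [List.map_inj_right]
    | cons x a ih =>
      cases a' with
      | nil => simp at h
      | cons x' a' =>
        simp only [List.map_cons, List.cons_append, List.cons.injEq, Option.some.injEq] at h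
        simpa [h.1] using ih a' h.2
  rw [(Term.symbols_append_inj _ _ _ _ h1.1).1, (Term.symbols_append_inj _ _ _ _ h1.2).1]

theorem TermIso.symbols_mapRule (φ : TermIso S T) (ρ : Rule S) :
    (φ.mapRule ρ).symbols = ρ.symbols.map (Option.map φ.onSymbol) := by
  simp [mapRule, Rule.symbols, symbols_mapTerm, Function.comp_def]

/-- The token of an entry of the symbol sequence of a rule. -/
def optionToken : Option (S.funs ⊕ S.vars) → Token := fun o => o.elim .arrow symbolToken

theorem optionToken_injective : Function.Injective (optionToken (S := S)) := by
  rintro (_ | s) (_ | s') h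
  · rfl
  · rcases s' with _ | _ <;> cases h
  · rcases s with _ | _ <;> cases h
  · exact congrArg _ (symbolToken_injective h)

/-- The tokens of a rule. -/
def Rule.tokens (ρ : Rule S) : List Token := ρ.symbols.map optionToken

theorem TermIso.forget_onSymbol {kf kv : Bool} {φ : TermIso S T} (h : φ.Respects kf kv)
    (s : S.funs ⊕ S.vars) :
    (symbolToken (φ.onSymbol s)).forget kf kv = (symbolToken s).forget kf kv := by
  rcases s with f | x
  · cases kf
    · simp [onSymbol, symbolToken, Token.forget, φ.arity_eq]
    · simp [onSymbol, symbolToken, Token.forget, φ.arity_eq, (h.1 rfl).2 f]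
  · cases kv
    · simp [onSymbol, symbolToken, Token.forget]
    · simp [onSymbol, symbolToken, Token.forget, (h.2 rfl).2 x]

/-! ### The criterion for the isomorphism of two rules -/

/-- The tokens of listed symbols. -/
def symbolTokens (LF : List S.funs) (LV : List S.vars) : List Token :=
  LF.map (fun f => symbolToken (.inl f)) ++ LV.map (fun x => symbolToken (.inr x))

/-- Forgotten tokens are colours that the admissible isomorphisms preserve. The permutation makes
colour classes of the signatures equally large, and the pattern provides the partial bijection that
has to be extended. -/
theorem exists_termIso_iff (kf kv : Bool) {LF : List S.funs} {LV : List S.vars} {LF' : List T.funs}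
    {LV' : List T.vars} (hF : LF.Nodup) (hF' : LF'.Nodup) (hV : LV.Nodup) (hV' : LV'.Nodup)
    (mF : ∀ f, f ∈ LF) (mF' : ∀ f, f ∈ LF') (mV : ∀ x, x ∈ LV) (mV' : ∀ x, x ∈ LV')
    (ρ : Rule S) (τ : Rule T) :
    (∃ φ : TermIso S T, φ.Respects kf kv ∧ φ.mapRule ρ = τ) ↔
      ((symbolTokens LF LV).map (Token.forget kf kv)).Perm
        ((symbolTokens LF' LV').map (Token.forget kf kv)) ∧
      SamePattern (Token.forget kf kv) ρ.tokens τ.tokens := by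
  constructor
  · rintro ⟨φ, hφ, rfl⟩
    constructor
    · have h1 : LF'.Perm (LF.map φ.onFun) :=
        (List.perm_ext_iff_of_nodup hF' (hF.map φ.onFun.injective)).2
          fun f => iff_of_true (mF' f) (List.mem_map.2 ⟨φ.onFun.symm f, mF _, by simp⟩)
      have h2 : LV'.Perm (LV.map φ.onVar) :=
        (List.perm_ext_iff_of_nodup hV' (hV.map φ.onVar.injective)).2
          fun f => iff_of_true (mV' f) (List.mem_map.2 ⟨φ.onVar.symm f, mV _, by simp⟩)
      refine List.Perm.trans (List.Perm.of_eq ?_) (((h1.map _).append (h2.map _)).map _).symm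
      simp only [symbolTokens, List.map_append, List.map_map]
      congr 1
      · exact List.map_congr_left fun f _ => (TermIso.forget_onSymbol hφ (.inl f)).symm
      · exact List.map_congr_left fun x _ => (TermIso.forget_onSymbol hφ (.inr x)).symm
    · have hinj : Function.Injective (Option.map φ.onSymbol) :=
        Option.map_injective φ.onSymbol_injective
      rw [Rule.tokens, Rule.tokens, φ.symbols_mapRule]
      refine ⟨by simp, fun a _ b _ => ⟨?_, ?_⟩⟩
      · simp only [List.getElem?_map, Option.map_map]
        congr 1
        funext o
        cases o with
        | none => rfl
        | some s => exact (TermIso.forget_onSymbol hφ s).symm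
      · simp only [List.getElem?_map, (Option.map_injective optionToken_injective).eq_iff,
          (Option.map_injective hinj).eq_iff]
  · rintro ⟨hperm, hlen, hpat⟩
    classical
    simp only [Rule.tokens, List.length_map, List.getElem?_map,
      (Option.map_injective optionToken_injective).eq_iff] at hlen hpat
    let cF : S.funs → Token := fun f => (symbolToken (.inl f)).forget kf kv
    let cF' : T.funs → Token := fun f => (symbolToken (.inl f)).forget kf kv
    let cV : S.vars → Token := fun x => (symbolToken (.inr x)).forget kf kv
    let cV' : T.vars → Token := fun x => (symbolToken (.inr x)).forget kf kv
    let isF : Token → Bool := fun t => t matches .function _ _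
    -- Forgetting keeps the kind of a symbol, so filtering splits the permutation into one for
    -- function symbols and one for variables.
    have hpF : (LF.map cF).Perm (LF'.map cF') := by
      have := hperm.filter isF
      simpa [symbolTokens, List.filter_map, Function.comp_def, isF, symbolToken, Token.forget,
        cF, cF'] using this
    have hpV : (LV.map cV).Perm (LV'.map cV') := by
      have := hperm.filter fun t => !isF t
      simpa [symbolTokens, List.filter_map, Function.comp_def, isF, symbolToken, Token.forget,
        cV, cV'] using this
    -- The prescribed pairs are the function symbols at equal positions of the two rules. Comparing
    -- a position with itself gives equal colours; comparing two positions gives a well-defined and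
    -- injective partial map.
    obtain ⟨eF, hcF, heF⟩ := exists_equiv_extending cF cF' (fun c => by
        rw [← hF.count_map_of_forall_mem mF, ← hF'.count_map_of_forall_mem mF', hpF.count_eq])
      {p | ∃ a < ρ.symbols.length, ρ.symbols[a]? = some (some (.inl p.1)) ∧
        τ.symbols[a]? = some (some (.inl p.2))} (by
        rintro ⟨f, g⟩ ⟨a, ha, h1, h2⟩
        have := (hpat a ha a ha).1
        rw [h1, h2] at this
        simpa [optionToken] using this) (by
        rintro ⟨f, g⟩ ⟨a, ha, h1, h2⟩ ⟨f', g'⟩ ⟨b, hb, h1', h2'⟩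
        have := (hpat a ha b hb).2
        rw [h1, h2, h1', h2'] at this
        simpa using this)
    obtain ⟨eV, hcV, heV⟩ := exists_equiv_extending cV cV' (fun c => by
        rw [← hV.count_map_of_forall_mem mV, ← hV'.count_map_of_forall_mem mV', hpV.count_eq])
      {p | ∃ a < ρ.symbols.length, ρ.symbols[a]? = some (some (.inr p.1)) ∧
        τ.symbols[a]? = some (some (.inr p.2))} (by
        rintro ⟨f, g⟩ ⟨a, ha, h1, h2⟩
        have := (hpat a ha a ha).1
        rw [h1, h2] at this
        simpa [optionToken] using this) (by
        rintro ⟨f, g⟩ ⟨a, ha, h1, h2⟩ ⟨f', g'⟩ ⟨b, hb, h1', h2'⟩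
        have := (hpat a ha b hb).2
        rw [h1, h2, h1', h2'] at this
        simpa using this)
    let φ : TermIso S T := ⟨eF, eV, fun f => by
      have := hcF f
      simp only [cF, cF', symbolToken, Token.forget, Token.function.injEq] at this
      exact this.2.symm⟩
    refine ⟨φ, ⟨?_, ?_⟩, Rule.symbols_injective ?_⟩
    -- When names are kept they are part of the colour, so `eF` fixes all names and the two sets of
    -- names coincide.
    · rintro rfl
      have hval : ∀ f, (eF f : ℕ) = f := fun f => by
        have := hcF f
        simp only [cF, cF', symbolToken, Token.forget, Token.function.injEq] at this
        exact this.1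
      refine ⟨?_, hval⟩
      ext n
      constructor
      · intro hn
        have := (eF ⟨n, hn⟩).2
        rwa [hval] at this
      · intro hn
        have := hval (eF.symm ⟨n, hn⟩)
        rw [eF.apply_symm_apply] at this
        rw [show n = _ from this]
        exact (eF.symm _).2
    · rintro rfl
      have hval : ∀ f, (eV f : ℕ) = f := fun f => by
        have := hcV f
        simp only [cV, cV', symbolToken, Token.forget, Token.variable.injEq] at this
        exact this
      refine ⟨?_, hval⟩
      ext n
      constructor
      · intro hn
        have := (eV ⟨n, hn⟩).2
        rwa [hval] at this
      · intro hn
        have := hval (eV.symm ⟨n, hn⟩)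
        rw [eV.apply_symm_apply] at this
        rw [show n = _ from this]
        exact (eV.symm _).2
    · rw [φ.symbols_mapRule]
      refine List.ext_getElem (by simpa using hlen) fun a ha ha' => ?_
      have hρ : a < ρ.symbols.length := by simpa using ha
      have := (hpat a hρ a hρ).1
      have h1 := List.getElem?_eq_getElem hρ
      have h2 := List.getElem?_eq_getElem ha'
      rw [List.getElem_map]
      rw [h1, h2] at this
      generalize ρ.symbols[a] = s at *
      generalize τ.symbols[a] = t at *
      simp only [Option.map_some, Option.some.injEq] at this
      rcases s with _ | f | x <;> rcases t with _ | g | y <;>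
        simp [optionToken, symbolToken, Token.forget] at this
      · rfl
      · simp [φ, TermIso.onSymbol, heF (f, g) ⟨a, hρ, h1, h2⟩]
      · simp [φ, TermIso.onSymbol, heV (x, y) ⟨a, hρ, h1, h2⟩]

end TermRewriting

/-! ### Constants and finite conjunctions in a logic of positions -/

namespace WordLogic.IsLogic

variable {α : Type} {D : ∀ n, (List α → (Fin n → ℕ) → Prop) → Prop} (hD : IsLogic D) {n : ℕ}

include hD

theorem true : D n fun _ _ => True :=
  hD.congr (fun _ _ _ => by simp) (hD.countEq (hD.lt 0 0) (hD.lt 0 0))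

theorem imp_const (p : Prop) {P : List α → (Fin n → ℕ) → Prop} (hP : D n P) :
    D n fun l v => p → P l v := by
  by_cases hp : p
  · simpa [hp] using hP
  · simpa [hp] using hD.true

theorem forall_mem {ι : Type} (L : List ι) {P : ι → List α → (Fin n → ℕ) → Prop}
    (hP : ∀ q, D n (P q)) : D n fun l v => ∀ q ∈ L, P q l v := by
  induction L with
  | nil => simpa using hD.true
  | cons q L ih => simpa using hD.and (hP q) ih

end WordLogic.IsLogic

namespace TermRewriting

open WordLogic

/-! ### Words as lists of tokens -/

/-- The letters that begin a token. -/
def Letter.isStart : Letter → Bool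
  | .bit _ => false
  | .arity => false
  | _ => true

/-- The code of a marker (`true` in front of rules, `false` in front of systems) or token. -/
def encodeToken : Bool ⊕ Token → List Letter
  | .inl b => [bif b then .rule else .system]
  | .inr .arrow => [.arrow]
  | .inr (.function n a) => .function :: encodeNumber n ++ .arity :: encodeNumber a
  | .inr (.variable n) => .variable :: encodeNumber n

theorem isStart_of_mem_encodeNumber {n : ℕ} {a : Letter} (h : a ∈ encodeNumber n) :
    a.isStart = false := by
  obtain ⟨b, -, rfl⟩ := List.mem_map.1 h
  rfl

theorem encodeNumber_injective : Function.Injective encodeNumber := by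
  intro m n h
  have := (List.map_injective_iff.2 fun a b h => by simpa using h) h
  rw [← Computability.decode_encodeNat m, this, Computability.decode_encodeNat]

theorem isSegmentCode_encodeToken : IsSegmentCode Letter.isStart encodeToken := by
  rintro (b | _ | ⟨n, a⟩ | n)
  · exact ⟨_, [], rfl, by cases b <;> rfl, by simp⟩
  · exact ⟨_, [], rfl, rfl, by simp⟩
  · refine ⟨_, _, rfl, rfl, fun c hc => ?_⟩
    simp only [List.append_eq, List.mem_append, List.mem_cons] at hc
    rcases hc with hc | rfl | hc
    · exact isStart_of_mem_encodeNumber hc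
    · rfl
    · exact isStart_of_mem_encodeNumber hc
  · exact ⟨_, _, rfl, rfl, fun c hc => isStart_of_mem_encodeNumber hc⟩

theorem takeWhile_encodeNumber_append (n : ℕ) {l : List Letter}
    (h : l.takeWhile (fun a => a matches .bit _) = []) :
    (encodeNumber n ++ l).takeWhile (fun a => a matches .bit _) = encodeNumber n := by
  rw [List.takeWhile_append_of_pos, h, List.append_nil]
  intro a ha
  obtain ⟨b, -, rfl⟩ := List.mem_map.1 ha
  rfl

/-- No token starts with a digit, so the last number of a token cannot run on into the next token.
-/
theorem takeWhile_flatMap_encodeToken (l : List (Bool ⊕ Token)) :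
    (l.flatMap encodeToken).takeWhile (fun a => a matches .bit _) = [] := by
  rcases l with _ | ⟨(b | _ | ⟨n, a⟩ | n), l⟩
  · rfl
  · cases b <;> simp [encodeToken]
  all_goals simp [encodeToken]

section

variable {l : List (Bool ⊕ Token)} {x : ℕ} (hx : x < l.length)

include hx

theorem bitsAfter_codePos : Dec.bitsAfter (l.flatMap encodeToken) (codePos encodeToken l x) =
    match l[x] with
    | .inr (.function n _) => encodeNumber n
    | .inr (.variable n) => encodeNumber n
    | _ => [] := by
  have hd := congrArg (List.drop 1) (drop_codePos (enc := encodeToken) hx)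
  rw [List.drop_drop] at hd
  rw [Dec.bitsAfter, hd]
  have hr := takeWhile_flatMap_encodeToken (l.drop (x + 1))
  rcases l[x] with b | _ | ⟨n, a⟩ | n
  · exact hr
  · exact hr
  · simp only [encodeToken, List.cons_append, List.drop_succ_cons, List.drop_zero,
      List.append_assoc]
    exact takeWhile_encodeNumber_append n (by simp)
  · simp only [encodeToken, List.cons_append, List.drop_succ_cons, List.drop_zero]
    exact takeWhile_encodeNumber_append n hr

/-- Only function tokens contain the letter `arity`, and just once, between name and arity. It gives
a formula access to the second number of the token. -/
theorem exists_arity_iff (z : ℕ) :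
    (z < (l.flatMap encodeToken).length ∧
      InSegment Letter.isStart (l.flatMap encodeToken) (codePos encodeToken l x) z ∧
      (l.flatMap encodeToken)[z]?.any (· = Letter.arity) = true) ↔
    ∃ n a, l[x] = .inr (.function n a) ∧
      z = codePos encodeToken l x + 1 + (encodeNumber n).length := by
  constructor
  · rintro ⟨hz, hseg, ha⟩
    obtain ⟨j, hj, rfl⟩ := (isSegmentCode_encodeToken.inSegment_iff hx hz).1 hseg
    rw [getElem?_codePos hx hj] at ha
    have hmem : ∀ n, Letter.arity ∉ encodeNumber n := fun n h => by
      obtain ⟨b, -, hb⟩ := List.mem_map.1 h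
      cases hb
    rw [List.getElem?_eq_getElem hj, Option.any_some, decide_eq_true_eq] at ha
    generalize l[x] = t at *
    rcases t with b | _ | ⟨n, a⟩ | n
    · simp [encodeToken] at hj
    · simp [encodeToken] at hj
    · refine ⟨n, a, rfl, ?_⟩
      simp only [encodeToken, List.cons_append, List.tail_cons] at hj ha
      rcases Nat.lt_trichotomy j (encodeNumber n).length with h | h | h
      · rw [List.getElem_append_left h] at ha
        exact absurd (ha ▸ List.getElem_mem h) (hmem n)
      · rw [h]
      · obtain ⟨k, rfl⟩ := Nat.exists_eq_add_of_lt h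
        rw [List.getElem_append_right (by omega)] at ha
        have hk : (encodeNumber n).length + k + 1 - (encodeNumber n).length = k + 1 := by omega
        simp only [hk, List.getElem_cons_succ] at ha
        exact absurd (ha ▸ List.getElem_mem _) (hmem a)
    · simp only [encodeToken, List.tail_cons] at hj ha
      exact absurd (ha ▸ List.getElem_mem hj) (hmem n)
  · rintro ⟨n, a, ht, rfl⟩
    have hj : (encodeNumber n).length < (encodeToken l[x]).tail.length := by
      simp [ht, encodeToken]
    have h1 := getElem?_codePos hx hj
    have hz : codePos encodeToken l x + 1 + (encodeNumber n).length <
        (l.flatMap encodeToken).length := by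
      rw [List.getElem?_eq_getElem hj] at h1
      exact (List.getElem?_eq_some_iff.1 h1).1
    refine ⟨hz, (isSegmentCode_encodeToken.inSegment_iff hx hz).2 ⟨_, hj, rfl⟩, ?_⟩
    rw [h1]
    simp [ht, encodeToken]

theorem bitsAfter_arity {n a : ℕ} (ht : l[x] = .inr (.function n a)) :
    Dec.bitsAfter (l.flatMap encodeToken) (codePos encodeToken l x + 1 + (encodeNumber n).length) =
      encodeNumber a := by
  have hd := congrArg (List.drop ((encodeNumber n).length + 2))
    (drop_codePos (enc := encodeToken) hx)
  rw [List.drop_drop, ht] at hd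
  rw [Dec.bitsAfter, show codePos encodeToken l x + 1 + (encodeNumber n).length + 1 =
    codePos encodeToken l x + ((encodeNumber n).length + 2) by omega, hd]
  have : (encodeToken (.inr (.function n a)) ++ (l.drop (x + 1)).flatMap encodeToken).drop
      ((encodeNumber n).length + 2) = encodeNumber a ++ (l.drop (x + 1)).flatMap encodeToken := by
    simp [encodeToken, List.drop_append]
  rw [this]
  exact takeWhile_encodeNumber_append a (takeWhile_flatMap_encodeToken _)

end

/-! ### Equality of tokens as a formula about letters -/

/-- The two positions belong to symbols of the same arity. -/
def SameArity (w : List Letter) (x y : ℕ) : Prop :=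
  ∃ z < w.length, ∃ u < w.length,
    (InSegment Letter.isStart w x z ∧ w[z]?.any (· = Letter.arity) = true) ∧
    (InSegment Letter.isStart w y u ∧ w[u]?.any (· = Letter.arity) = true) ∧
    Dec.bitsAfter w z = Dec.bitsAfter w u

theorem sameArity_codePos {l : List (Bool ⊕ Token)} {x y : ℕ} (hx : x < l.length)
    (hy : y < l.length) :
    SameArity (l.flatMap encodeToken) (codePos encodeToken l x) (codePos encodeToken l y) ↔
      ∃ n m a, l[x] = .inr (.function n a) ∧ l[y] = .inr (.function m a) := by
  constructor
  · rintro ⟨z, hz, u, hu, h1, h2, h⟩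
    obtain ⟨n, a, ha, rfl⟩ := (exists_arity_iff hx z).1 ⟨hz, h1⟩
    obtain ⟨m, b, hb, rfl⟩ := (exists_arity_iff hy u).1 ⟨hu, h2⟩
    rw [bitsAfter_arity hx ha, bitsAfter_arity hy hb] at h
    obtain rfl := encodeNumber_injective h
    exact ⟨n, m, a, ha, hb⟩
  · rintro ⟨n, m, a, ha, hb⟩
    obtain ⟨hz, h1⟩ := (exists_arity_iff hx _).2 ⟨n, a, ha, rfl⟩
    obtain ⟨hu, h2⟩ := (exists_arity_iff hy _).2 ⟨m, a, hb, rfl⟩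
    exact ⟨_, hz, _, hu, h1, h2, by rw [bitsAfter_arity hx ha, bitsAfter_arity hy hb]⟩

theorem dec_sameArity {n : ℕ} (i j : Fin n) : Dec n fun w v => SameArity w (v i) (v j) := by
  have hD := Dec.isLogic
  refine hD.ex (P' := fun w v z => ∃ u < w.length,
    (InSegment Letter.isStart w (v i) z ∧ w[z]?.any (· = Letter.arity) = true) ∧
    (InSegment Letter.isStart w (v j) u ∧ w[u]?.any (· = Letter.arity) = true) ∧
    Dec.bitsAfter w z = Dec.bitsAfter w u) (hD.ex (P' := fun w v u =>
    (InSegment Letter.isStart w (v i.succ) (v 0) ∧ w[v 0]?.any (· = Letter.arity) = true) ∧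
    (InSegment Letter.isStart w (v j.succ) u ∧ w[u]?.any (· = Letter.arity) = true) ∧
    Dec.bitsAfter w (v 0) = Dec.bitsAfter w u) ?_)
  exact hD.and (hD.and (hD.inSegment (fun _ => Dec.letter _) i.succ.succ 1) (Dec.letter _ 1))
    (hD.and (hD.and (hD.inSegment (fun _ => Dec.letter _) j.succ.succ 0) (Dec.letter _ 0))
      (Dec.sameBits (by simp)))

/-- The properties of lists of tokens that are decidable from their codes. -/
abbrev TokenDec := Encoded Dec encodeToken

theorem TokenDec.isLogic : IsLogic TokenDec :=
  Encoded.isLogic Dec.isLogic (fun _ => Dec.letter _) isSegmentCode_encodeToken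

/-- Equality of tokens up to forgetting names. -/
theorem TokenDec.forget (kf kv : Bool) {n : ℕ} {i j : Fin n} (hij : i ≠ j) :
    TokenDec n fun l v => l[v i]?.map (Sum.map id (Token.forget kf kv)) =
      l[v j]?.map (Sum.map id (Token.forget kf kv)) := by
  have hD := Dec.isLogic
  -- The five letters are all possible first letters of a token or marker, so the first conjunct
  -- says that both are of the same kind. Then arities are compared, and names as far as the flags
  -- demand.
  refine ⟨_, hD.and (hD.forall_mem [Letter.rule, .system, .arrow, .function, .variable]
    fun q => hD.iff (Dec.letter (· = q) i) (Dec.letter (· = q) j))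
    (hD.and (hD.imp (Dec.letter (· = Letter.function) i)
      (hD.and (hD.imp_const (kf = Bool.true) (Dec.sameBits hij)) (dec_sameArity i j)))
      (hD.imp (Dec.letter (· = Letter.variable) i)
        (hD.imp_const (kv = Bool.true) (Dec.sameBits hij)))), fun l v hv => ?_⟩
  simp only [isSegmentCode_encodeToken.head?_drop (hv i),
    isSegmentCode_encodeToken.head?_drop (hv j), bitsAfter_codePos (hv i),
    bitsAfter_codePos (hv j), sameArity_codePos (hv i) (hv j), List.getElem?_eq_getElem (hv i),
    List.getElem?_eq_getElem (hv j)]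
  generalize l[v i]'(hv i) = s
  generalize l[v j]'(hv j) = t
  rcases s with b | _ | ⟨n, a⟩ | n <;> rcases t with c | _ | ⟨m, a'⟩ | m <;>
    (try cases b) <;> (try cases c) <;>
    simp [encodeToken, Token.forget, encodeNumber_injective.eq_iff]
  · cases kf <;> simp
  · cases kv <;> simp

theorem TokenDec.eq {n : ℕ} {i j : Fin n} (hij : i ≠ j) :
    TokenDec n fun l v => l[v i]? = l[v j]? := by
  have : Sum.map id (Token.forget Bool.true Bool.true) = (id : Bool ⊕ Token → _) := by
    funext t
    rcases t with b | _ | ⟨n, a⟩ | n <;> rfl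
  simpa [this] using TokenDec.forget Bool.true Bool.true hij

end TermRewriting

namespace WordLogic

/-! ### Patterns -/

section

variable {α γ : Type} {f : α → γ} {s t u : List α}

theorem SamePattern.symm (h : SamePattern f s t) : SamePattern f t s :=
  ⟨h.1.symm, fun a ha b hb =>
    ⟨(h.2 a (h.1 ▸ ha) b (h.1 ▸ hb)).1.symm, (h.2 a (h.1 ▸ ha) b (h.1 ▸ hb)).2.symm⟩⟩

theorem SamePattern.trans (h : SamePattern f s t) (h' : SamePattern f t u) : SamePattern f s u :=
  ⟨h.1.trans h'.1, fun a ha b hb =>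
    ⟨(h.2 a ha b hb).1.trans (h'.2 a (h.1 ▸ ha) b (h.1 ▸ hb)).1,
      (h.2 a ha b hb).2.trans (h'.2 a (h.1 ▸ ha) b (h.1 ▸ hb)).2⟩⟩

theorem samePattern_map_inr {ι : Type} :
    SamePattern (Sum.map (id : ι → ι) f) (s.map .inr) (t.map .inr) ↔ SamePattern f s t := by
  have h1 : ∀ o o' : Option α, (o.map Sum.inr).map (Sum.map (id : ι → ι) f) =
      (o'.map Sum.inr).map (Sum.map (id : ι → ι) f) ↔ o.map f = o'.map f := by
    rintro (_ | a) (_ | b) <;> simp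
  have h2 : ∀ o o' : Option α,
      o.map (Sum.inr : α → ι ⊕ α) = o'.map Sum.inr ↔ o = o' := by
    rintro (_ | a) (_ | b) <;> simp
  simp only [SamePattern, List.length_map, List.getElem?_map, h1, h2]

theorem perm_map_inr {ι : Type} :
    ((s.map Sum.inr).map (Sum.map (id : ι → ι) f)).Perm
      ((t.map Sum.inr).map (Sum.map (id : ι → ι) f)) ↔ (s.map f).Perm (t.map f) := by
  have : ∀ s : List α, (s.map Sum.inr).map (Sum.map (id : ι → ι) f) =
      (s.map f).map Sum.inr := fun s => by simp
  rw [this, this, List.map_perm_map_iff Sum.inr_injective]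

end

end WordLogic

namespace TermRewriting

open WordLogic

/-! ### Words as lists of blocks -/

/-- A rule (`true`) or the list of symbols of a system (`false`). -/
abbrev Block := Bool × List Token

/-- The code of a block. -/
def encodeBlock (b : Block) : List (Bool ⊕ Token) :=
  .inl b.1 :: b.2.map .inr

theorem isSegmentCode_encodeBlock : IsSegmentCode Sum.isLeft encodeBlock := fun b =>
  ⟨_, _, rfl, rfl, by simp⟩

theorem tokenDec_isLeft (n : ℕ) (i : Fin n) : TokenDec n fun l v => l[v i]?.any Sum.isLeft = true := by
  have hD := TokenDec.isLogic
  have h : ∀ b : Bool, TokenDec n fun l v => l[v i]?.any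
      (fun t => (encodeToken t).head?.any (· = bif b then Letter.rule else .system)) = true :=
    fun b => Encoded.head isSegmentCode_encodeToken (Dec.letter _ i)
  refine hD.congr (fun l v hv => ?_) (hD.or (h true) (h false))
  rw [List.getElem?_eq_getElem (hv i)]
  generalize l[v i]'(hv i) = t
  rcases t with (_ | _) | _ | ⟨n, a⟩ | n <;> simp [encodeToken]

theorem tokenDec_rule (n : ℕ) (i : Fin n) :
    TokenDec n fun l v => l[v i]?.any (fun t => t matches .inl true) = true := by
  refine TokenDec.isLogic.congr (fun l v hv => ?_)
    (Encoded.head isSegmentCode_encodeToken (Dec.letter (· = Letter.rule) i))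
  rw [List.getElem?_eq_getElem (hv i)]
  generalize l[v i]'(hv i) = t
  rcases t with (_ | _) | _ | ⟨n, a⟩ | n <;> simp [encodeToken]

/-- The properties of lists of blocks that are decidable from their codes. -/
abbrev BlockDec := Encoded TokenDec encodeBlock

theorem BlockDec.isLogic : IsLogic BlockDec :=
  Encoded.isLogic TokenDec.isLogic tokenDec_isLeft isSegmentCode_encodeBlock

/-- The block at a position is a rule. -/
def RuleAt (l : List Block) (x : ℕ) : Prop := l[x]?.any Prod.fst = true

theorem BlockDec.ruleAt {n : ℕ} (i : Fin n) : BlockDec n fun l v => RuleAt l (v i) := by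
  refine BlockDec.isLogic.congr (fun l v hv => ?_)
    (Encoded.head isSegmentCode_encodeBlock (tokenDec_rule n i))
  rw [RuleAt, List.getElem?_eq_getElem (hv i)]
  generalize l[v i]'(hv i) = t
  rcases t with ⟨_ | _, t⟩ <;> simp [encodeBlock]

variable (kf kv : Bool)

theorem BlockDec.perm {n : ℕ} (i j : Fin n) : BlockDec n fun l v =>
    AtPair (fun b b' : Block => (b.2.map (Token.forget kf kv)).Perm (b'.2.map (Token.forget kf kv)))
      l (v i) (v j) := by
  simpa only [encodeBlock, List.tail_cons, perm_map_inr] using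
    Encoded.perm TokenDec.isLogic tokenDec_isLeft isSegmentCode_encodeBlock
      (fun _ _ _ => TokenDec.forget kf kv) i j

theorem BlockDec.samePattern {n : ℕ} (i j : Fin n) : BlockDec n fun l v =>
    AtPair (fun b b' : Block => SamePattern (Token.forget kf kv) b.2 b'.2) l (v i) (v j) := by
  simpa only [encodeBlock, List.tail_cons, samePattern_map_inr] using
    Encoded.samePattern TokenDec.isLogic tokenDec_isLeft isSegmentCode_encodeBlock
      (fun _ _ _ => TokenDec.forget kf kv) (fun _ _ _ => TokenDec.eq) i j

/-! ### The formula for local isomorphism -/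

/-- The position is before the second system. -/
def InFirst (l : List Block) (x : ℕ) : Prop :=
  ∃ z < l.length, ¬ RuleAt l z ∧ x < z

theorem BlockDec.inFirst {n : ℕ} (i : Fin n) : BlockDec n fun l v => InFirst l (v i) :=
  BlockDec.isLogic.ex (P' := fun l v z => ¬ RuleAt l z ∧ v i < z)
    (BlockDec.isLogic.and (BlockDec.isLogic.not (BlockDec.ruleAt 0))
      (BlockDec.isLogic.lt i.succ 0))

/-- The systems of two positions have the same numbers of symbols of each kind. -/
def SameSymbolsAt (l : List Block) (x y : ℕ) : Prop :=
  ∃ s < l.length, ∃ t < l.length, ¬ RuleAt l s ∧ ¬ RuleAt l t ∧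
    (InFirst l s ↔ InFirst l x) ∧ (InFirst l t ↔ InFirst l y) ∧
    AtPair (fun b b' : Block =>
      (b.2.map (Token.forget kf kv)).Perm (b'.2.map (Token.forget kf kv))) l s t

theorem BlockDec.sameSymbolsAt {n : ℕ} (i j : Fin n) :
    BlockDec n fun l v => SameSymbolsAt kf kv l (v i) (v j) := by
  have hD := BlockDec.isLogic
  refine hD.ex (P' := fun l v s => ∃ t < l.length, ¬ RuleAt l s ∧ ¬ RuleAt l t ∧
    (InFirst l s ↔ InFirst l (v i)) ∧ (InFirst l t ↔ InFirst l (v j)) ∧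
    AtPair (fun b b' : Block =>
      (b.2.map (Token.forget kf kv)).Perm (b'.2.map (Token.forget kf kv))) l s t)
    (hD.ex (P' := fun l v t => ¬ RuleAt l (v 0) ∧ ¬ RuleAt l t ∧
      (InFirst l (v 0) ↔ InFirst l (v i.succ)) ∧ (InFirst l t ↔ InFirst l (v j.succ)) ∧
      AtPair (fun b b' : Block =>
        (b.2.map (Token.forget kf kv)).Perm (b'.2.map (Token.forget kf kv))) l (v 0) t) ?_)
  exact hD.and (hD.not (BlockDec.ruleAt 1)) (hD.and (hD.not (BlockDec.ruleAt 0))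
    (hD.and (hD.iff (BlockDec.inFirst 1) (BlockDec.inFirst i.succ.succ))
      (hD.and (hD.iff (BlockDec.inFirst 0) (BlockDec.inFirst j.succ.succ))
        (BlockDec.perm kf kv 1 0))))

/-- The rules at two positions are isomorphic. -/
def IsoAt (l : List Block) (x y : ℕ) : Prop :=
  AtPair (fun b b' : Block => SamePattern (Token.forget kf kv) b.2 b'.2) l x y ∧
    SameSymbolsAt kf kv l x y

/-- No two distinct rules of one of the systems are isomorphic, and every rule of each of the
systems is isomorphic to a rule of the other one. -/
def LocalIsoFormula (l : List Block) : Prop :=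
  ∀ x < l.length, RuleAt l x →
    (∀ y < l.length, RuleAt l y → (InFirst l x ↔ InFirst l y) → x < y → ¬ IsoAt kf kv l x y) ∧
    ∃ y < l.length, RuleAt l y ∧ ¬ (InFirst l x ↔ InFirst l y) ∧ IsoAt kf kv l x y

theorem BlockDec.localIsoFormula : BlockDec 0 fun l _ => LocalIsoFormula kf kv l := by
  have hD := BlockDec.isLogic
  have hiso : ∀ n (i j : Fin n), BlockDec n fun l v => IsoAt kf kv l (v i) (v j) :=
    fun n i j => hD.and (BlockDec.samePattern kf kv i j) (BlockDec.sameSymbolsAt kf kv i j)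
  refine hD.all (P' := fun l _ x => RuleAt l x →
    (∀ y < l.length, RuleAt l y → (InFirst l x ↔ InFirst l y) → x < y → ¬ IsoAt kf kv l x y) ∧
    ∃ y < l.length, RuleAt l y ∧ ¬ (InFirst l x ↔ InFirst l y) ∧ IsoAt kf kv l x y)
    (hD.imp (BlockDec.ruleAt 0) (hD.and ?_ ?_))
  · exact hD.all (P' := fun l v y => RuleAt l y → (InFirst l (v 0) ↔ InFirst l y) → v 0 < y →
      ¬ IsoAt kf kv l (v 0) y) (hD.imp (BlockDec.ruleAt 0)
      (hD.imp (hD.iff (BlockDec.inFirst 1) (BlockDec.inFirst 0)) (hD.imp (hD.lt 1 0)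
        (hD.not (hiso _ 1 0)))))
  · exact hD.ex (P' := fun l v y => RuleAt l y ∧ ¬ (InFirst l (v 0) ↔ InFirst l y) ∧
      IsoAt kf kv l (v 0) y) (hD.and (BlockDec.ruleAt 0)
      (hD.and (hD.not (hD.iff (BlockDec.inFirst 1) (BlockDec.inFirst 0))) (hiso _ 1 0)))

/-! ### The meaning of the formula -/

/-- The blocks of a pair of systems, given by their symbols and rules. -/
def blocks (A B : List Token) (L L' : List (List Token)) : List Block :=
  (false, A) :: L.map (Prod.mk true) ++ (false, B) :: L'.map (Prod.mk true)

section

variable {A B : List Token} {L L' : List (List Token)}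

theorem blocks_getElem?_zero : (blocks A B L L')[0]? = some (false, A) := rfl

theorem blocks_getElem?_succ {i : ℕ} (hi : i < L.length) :
    (blocks A B L L')[i + 1]? = some (true, L[i]) := by
  rw [blocks, List.getElem?_append_left (by simpa using hi)]
  simp [hi]

theorem blocks_getElem?_middle : (blocks A B L L')[L.length + 1]? = some (false, B) := by
  rw [blocks, List.getElem?_append_right (by simp)]
  simp

theorem blocks_getElem?_last {i : ℕ} (hi : i < L'.length) :
    (blocks A B L L')[L.length + 2 + i]? = some (true, L'[i]) := by
  rw [blocks, List.getElem?_append_right (by simp; omega)]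
  simp only [List.length_cons, List.length_map]
  rw [show L.length + 2 + i - (L.length + 1) = i + 1 by omega]
  simp [hi]

theorem length_blocks : (blocks A B L L').length = L.length + 2 + L'.length := by
  simp [blocks]
  omega

theorem blocks_cases {x : ℕ} (hx : x < (blocks A B L L').length) :
    x = 0 ∨ (∃ i < L.length, x = i + 1) ∨ x = L.length + 1 ∨
      ∃ i < L'.length, x = L.length + 2 + i := by
  rw [length_blocks] at hx
  rcases Nat.lt_trichotomy x (L.length + 1) with h | h | h
  · rcases x with _ | x
    · exact .inl rfl
    · exact .inr (.inl ⟨x, by omega, rfl⟩)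
  · exact .inr (.inr (.inl h))
  · exact .inr (.inr (.inr ⟨x - (L.length + 2), by omega, by omega⟩))

theorem ruleAt_blocks_iff {x : ℕ} : x < (blocks A B L L').length ∧ RuleAt (blocks A B L L') x ↔
    (∃ i < L.length, x = i + 1) ∨ ∃ i < L'.length, x = L.length + 2 + i := by
  constructor
  · rintro ⟨hx, h⟩
    rcases blocks_cases hx with rfl | h' | rfl | h'
    · simp [RuleAt, blocks_getElem?_zero] at h
    · exact .inl h'
    · simp [RuleAt, blocks_getElem?_middle] at h
    · exact .inr h'
  · rintro (⟨i, hi, rfl⟩ | ⟨i, hi, rfl⟩)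
    · exact ⟨by rw [length_blocks]; omega, by simp [RuleAt, blocks_getElem?_succ hi]⟩
    · exact ⟨by rw [length_blocks]; omega, by simp [RuleAt, blocks_getElem?_last hi]⟩

theorem not_ruleAt_blocks_iff {x : ℕ} :
    x < (blocks A B L L').length ∧ ¬ RuleAt (blocks A B L L') x ↔ x = 0 ∨ x = L.length + 1 := by
  constructor
  · rintro ⟨hx, h⟩
    by_contra h'
    refine h (ruleAt_blocks_iff.2 ?_).2
    rcases blocks_cases hx with h1 | h1 | h1 | h1
    · exact absurd (.inl h1) h'
    · exact .inl h1
    · exact absurd (.inr h1) h'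
    · exact .inr h1
  · rintro (rfl | rfl)
    · exact ⟨by rw [length_blocks]; omega, by simp [RuleAt, blocks_getElem?_zero]⟩
    · exact ⟨by rw [length_blocks]; omega, by simp [RuleAt, blocks_getElem?_middle]⟩

theorem inFirst_blocks_iff {x : ℕ} : InFirst (blocks A B L L') x ↔ x < L.length + 1 := by
  constructor
  · rintro ⟨z, hz, hr, hx⟩
    have := not_ruleAt_blocks_iff.1 ⟨hz, hr⟩
    omega
  · intro hx
    have := not_ruleAt_blocks_iff (A := A) (B := B) (L := L) (L' := L').2 (.inr rfl)
    exact ⟨_, this.1, this.2, hx⟩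

/-- Each system has one block of symbols, so the block that agrees with a position under `InFirst`
is the one of the system of that position. -/
theorem sameSymbolsAt_blocks_iff {x y : ℕ} : SameSymbolsAt kf kv (blocks A B L L') x y ↔
    ((if x < L.length + 1 then A else B).map (Token.forget kf kv)).Perm
      ((if y < L.length + 1 then A else B).map (Token.forget kf kv)) := by
  have hat : ∀ (x : ℕ) (s : ℕ), (s = 0 ∨ s = L.length + 1) →
      (s < L.length + 1 ↔ x < L.length + 1) →
      (blocks A B L L')[s]? = some (false, if x < L.length + 1 then A else B) := by
    rintro x s (rfl | rfl) h
    · rw [blocks_getElem?_zero, if_pos (by omega)]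
    · rw [blocks_getElem?_middle, if_neg (by omega)]
  simp only [SameSymbolsAt, inFirst_blocks_iff]
  constructor
  · rintro ⟨s, hs, t, ht, hs', ht', h1, h2, h⟩
    exact h _ (hat x s (not_ruleAt_blocks_iff.1 ⟨hs, hs'⟩) h1) _
      (hat y t (not_ruleAt_blocks_iff.1 ⟨ht, ht'⟩) h2)
  · intro h
    have hex : ∀ x : ℕ, ∃ s, (s = 0 ∨ s = L.length + 1) ∧
        (s < L.length + 1 ↔ x < L.length + 1) := by
      intro x
      by_cases hx : x < L.length + 1
      · exact ⟨0, .inl rfl, by omega⟩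
      · exact ⟨L.length + 1, .inr rfl, by omega⟩
    obtain ⟨s, hs, h1⟩ := hex x
    obtain ⟨t, ht, h2⟩ := hex y
    obtain ⟨hs1, hs2⟩ := not_ruleAt_blocks_iff (A := A) (B := B) (L := L) (L' := L').2 hs
    obtain ⟨ht1, ht2⟩ := not_ruleAt_blocks_iff (A := A) (B := B) (L := L) (L' := L').2 ht
    refine ⟨s, hs1, t, ht1, hs2, ht2, h1, h2, ?_⟩
    rintro b hb b' hb'
    rw [hat x s hs h1] at hb
    rw [hat y t ht h2] at hb'
    cases hb
    cases hb'
    exact h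

/-- Two rules of systems with given symbols are isomorphic. -/
def TokenIso (A B ρ τ : List Token) : Prop :=
  (A.map (Token.forget kf kv)).Perm (B.map (Token.forget kf kv)) ∧
    SamePattern (Token.forget kf kv) ρ τ

variable {kf kv} in
theorem TokenIso.symm {ρ τ : List Token} (h : TokenIso kf kv A B ρ τ) : TokenIso kf kv B A τ ρ :=
  ⟨h.1.symm, h.2.symm⟩

variable {kf kv} in
theorem TokenIso.trans {C ρ τ σ : List Token} (h : TokenIso kf kv A B ρ τ)
    (h' : TokenIso kf kv B C τ σ) : TokenIso kf kv A C ρ σ :=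
  ⟨h.1.trans h'.1, h.2.trans h'.2⟩

theorem isoAt_blocks_iff {x y : ℕ} {b b' : Block} (hx : (blocks A B L L')[x]? = some b)
    (hy : (blocks A B L L')[y]? = some b') : IsoAt kf kv (blocks A B L L') x y ↔
      TokenIso kf kv (if x < L.length + 1 then A else B) (if y < L.length + 1 then A else B)
        b.2 b'.2 := by
  simp only [IsoAt, sameSymbolsAt_blocks_iff, TokenIso, AtPair, hx, hy, Option.mem_def,
    Option.some.injEq, forall_eq']
  exact and_comm

/-- Each system is preceded by its block of symbols, so rule `i` of the first system is at position
`i + 1`, and rule `i` of the second at `L.length + 2 + i`. Quantifiers over rule positions split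
accordingly. -/
theorem localIsoFormula_blocks_iff : LocalIsoFormula kf kv (blocks A B L L') ↔
    (L.Pairwise fun ρ τ => ¬ TokenIso kf kv A A ρ τ) ∧
    (L'.Pairwise fun ρ τ => ¬ TokenIso kf kv B B ρ τ) ∧
    (∀ ρ ∈ L, ∃ τ ∈ L', TokenIso kf kv A B ρ τ) ∧ ∀ τ ∈ L', ∃ ρ ∈ L, TokenIso kf kv B A τ ρ := by
  have hall : ∀ p : ℕ → Prop, (∀ x < (blocks A B L L').length, RuleAt (blocks A B L L') x → p x) ↔
      (∀ i < L.length, p (i + 1)) ∧ ∀ i < L'.length, p (L.length + 2 + i) := by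
    intro p
    constructor
    · intro h
      refine ⟨fun i hi => ?_, fun i hi => ?_⟩
      · have := ruleAt_blocks_iff (A := A) (B := B) (L := L) (L' := L').2 (.inl ⟨i, hi, rfl⟩)
        exact h _ this.1 this.2
      · have := ruleAt_blocks_iff (A := A) (B := B) (L := L) (L' := L').2 (.inr ⟨i, hi, rfl⟩)
        exact h _ this.1 this.2
    · rintro ⟨h1, h2⟩ x hx hr
      rcases ruleAt_blocks_iff.1 ⟨hx, hr⟩ with ⟨i, hi, rfl⟩ | ⟨i, hi, rfl⟩
      · exact h1 i hi
      · exact h2 i hi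
  have hex : ∀ p : ℕ → Prop, (∃ x < (blocks A B L L').length, RuleAt (blocks A B L L') x ∧ p x) ↔
      (∃ i < L.length, p (i + 1)) ∨ ∃ i < L'.length, p (L.length + 2 + i) := by
    intro p
    rw [← not_iff_not]
    push Not
    exact hall _
  have h11 : ∀ i (hi : i < L.length) j (hj : j < L.length),
      IsoAt kf kv (blocks A B L L') (i + 1) (j + 1) ↔ TokenIso kf kv A A L[i] L[j] :=
    fun i hi j hj => by
      rw [isoAt_blocks_iff kf kv (blocks_getElem?_succ hi) (blocks_getElem?_succ hj),
        if_pos (by omega), if_pos (by omega)]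
  have h12 : ∀ i (hi : i < L.length) j (hj : j < L'.length),
      IsoAt kf kv (blocks A B L L') (i + 1) (L.length + 2 + j) ↔ TokenIso kf kv A B L[i] L'[j] :=
    fun i hi j hj => by
      rw [isoAt_blocks_iff kf kv (blocks_getElem?_succ hi) (blocks_getElem?_last hj),
        if_pos (by omega), if_neg (by omega)]
  have h21 : ∀ i (hi : i < L'.length) j (hj : j < L.length),
      IsoAt kf kv (blocks A B L L') (L.length + 2 + i) (j + 1) ↔ TokenIso kf kv B A L'[i] L[j] :=
    fun i hi j hj => by
      rw [isoAt_blocks_iff kf kv (blocks_getElem?_last hi) (blocks_getElem?_succ hj),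
        if_neg (by omega), if_pos (by omega)]
  have h22 : ∀ i (hi : i < L'.length) j (hj : j < L'.length),
      IsoAt kf kv (blocks A B L L') (L.length + 2 + i) (L.length + 2 + j) ↔
        TokenIso kf kv B B L'[i] L'[j] :=
    fun i hi j hj => by
      rw [isoAt_blocks_iff kf kv (blocks_getElem?_last hi) (blocks_getElem?_last hj),
        if_neg (by omega), if_neg (by omega)]
  simp only [LocalIsoFormula, hall, hex, inFirst_blocks_iff, List.pairwise_iff_getElem,
    List.forall_mem_iff_getElem, List.exists_mem_iff_getElem]
  constructor
  · rintro ⟨h1, h2⟩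
    refine ⟨fun i j hi hj hij => ?_, fun i j hi hj hij => ?_, fun i hi => ?_, fun i hi => ?_⟩
    · rw [← h11]
      exact (h1 i hi).1.1 j hj (by omega) (by omega)
    · rw [← h22]
      exact (h2 i hi).1.2 j hj (by omega) (by omega)
    · rcases (h1 i hi).2 with ⟨j, hj, hne, -⟩ | ⟨j, hj, -, h⟩
      · omega
      · exact ⟨j, hj, (h12 i hi j hj).1 h⟩
    · rcases (h2 i hi).2 with ⟨j, hj, -, h⟩ | ⟨j, hj, hne, -⟩
      · exact ⟨j, hj, (h21 i hi j hj).1 h⟩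
      · omega
  · rintro ⟨h1, h2, h3, h4⟩
    refine ⟨fun i hi => ⟨⟨fun j hj _ hij => ?_, fun j hj _ _ => by omega⟩, .inr ?_⟩,
      fun i hi => ⟨⟨fun j hj _ _ => by omega, fun j hj _ hij => ?_⟩, .inl ?_⟩⟩
    · rw [h11 i hi j hj]
      exact h1 i j hi hj (by omega)
    · obtain ⟨j, hj, h⟩ := h3 i hi
      exact ⟨j, hj, by omega, (h12 i hi j hj).2 h⟩
    · rw [h22 i hi j hj]
      exact h2 i j hi hj (by omega)
    · obtain ⟨j, hj, h⟩ := h4 i hi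
      exact ⟨j, hj, by omega, (h21 i hi j hj).2 h⟩

end

end TermRewriting

namespace TermRewriting

open WordLogic

variable {S : Signature}

/-! ### Codes of systems -/

theorem encodeTerm_eq (t : Term S) :
    encodeTerm t = t.symbols.flatMap fun s => encodeToken (.inr (symbolToken s)) := by
  induction t with
  | var x => simp [encodeTerm, Term.symbols, encodeVar, symbolToken, encodeToken]
  | app f ts ih =>
    simp only [encodeTerm, Term.symbols, List.flatMap_cons, ih]
    congr 1
    simp [List.flatMap, List.map_flatten, List.flatten_flatten, List.map_ofFn, Function.comp_def]

theorem encodeRule_eq (ρ : Rule S) :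
    encodeRule ρ = (encodeBlock (true, ρ.tokens)).flatMap encodeToken := by
  simp [encodeRule, encodeBlock, Rule.tokens, Rule.symbols, encodeTerm_eq, List.flatMap_map,
    encodeToken, optionToken]

theorem encodeTRS_eq (R : ListedTRS) :
    encodeTRS R = (((false, symbolTokens R.funList R.varList) ::
      R.ruleList.map fun ρ => (true, ρ.tokens)).flatMap encodeBlock).flatMap encodeToken := by
  simp only [encodeTRS, List.flatMap_cons, List.flatMap_append, List.flatMap_map,
    List.flatMap_assoc, ← encodeRule_eq]
  simp [encodeBlock, encodeToken, symbolTokens, symbolToken, List.flatMap_map,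
    encodeVar]
  rfl

/-- The blocks of the code of a pair of systems. -/
def pairBlocks (p : ListedTRS × ListedTRS) : List Block :=
  blocks (symbolTokens p.1.funList p.1.varList) (symbolTokens p.2.funList p.2.varList)
    (p.1.ruleList.map Rule.tokens) (p.2.ruleList.map Rule.tokens)

theorem encodePair_eq (p : ListedTRS × ListedTRS) :
    encodePair p = ((pairBlocks p).flatMap encodeBlock).flatMap encodeToken := by
  rw [encodePair, encodeTRS_eq, encodeTRS_eq, ← List.flatMap_append, ← List.flatMap_append]
  simp [pairBlocks, blocks, Function.comp_def]

/-! ### Local isomorphisms -/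

variable (kf kv : Bool)

/-- No two distinct rules are equal up to an isomorphism with the required invariance. -/
def TRS.NormalFormKeeping (R : TRS) : Prop :=
  ∀ ρ ∈ R.rules, ∀ τ ∈ R.rules, ρ ≠ τ →
    ¬ ∃ φ : TermIso R.sig R.sig, φ.Respects kf kv ∧ φ.mapRule ρ = τ

/-- Local isomorphism by isomorphisms with the required invariance. -/
def LocallyIsoKeeping (R R' : TRS) : Prop :=
  R.NormalFormKeeping kf kv ∧ R'.NormalFormKeeping kf kv ∧
    ∃ φ : R.rules → TermIso R.sig R'.sig, (∀ ρ, (φ ρ).Respects kf kv) ∧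
      localImage R R' φ = (R'.rules : Set (Rule R'.sig))

/-- Once both systems are in normal form, covering the second system by images of rules of the first
one amounts to partners existing in both directions. -/
theorem locallyIsoKeeping_iff (R R' : ListedTRS) :
    LocallyIsoKeeping kf kv R.toTRS R'.toTRS ↔ LocalIsoFormula kf kv (pairBlocks (R, R')) := by
  have hiso : ∀ (R R' : ListedTRS) (ρ : Rule R.sig) (τ : Rule R'.sig),
      (∃ φ : TermIso R.sig R'.sig, φ.Respects kf kv ∧ φ.mapRule ρ = τ) ↔
        TokenIso kf kv (symbolTokens R.funList R.varList) (symbolTokens R'.funList R'.varList)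
          ρ.tokens τ.tokens := fun R R' ρ τ =>
    exists_termIso_iff kf kv R.funList_nodup R'.funList_nodup R.varList_nodup R'.varList_nodup
      R.mem_funList R'.mem_funList R.mem_varList R'.mem_varList ρ τ
  have hnormal : ∀ R : ListedTRS, R.toTRS.NormalFormKeeping kf kv ↔
      (R.ruleList.map Rule.tokens).Pairwise fun ρ τ =>
        ¬ TokenIso kf kv (symbolTokens R.funList R.varList) (symbolTokens R.funList R.varList)
          ρ τ := by
    intro R
    rw [List.pairwise_map]
    simp only [TRS.NormalFormKeeping, hiso R R, ← R.mem_ruleList]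
    constructor
    · intro h
      exact R.ruleList_nodup.imp_of_mem fun ha hb hab => h _ ha _ hb hab
    · intro h ρ hρ τ hτ hne
      -- By symmetry, it is enough to compare each rule with the later ones in the list.
      have : Std.Symm fun ρ τ : Rule R.sig => ¬ TokenIso kf kv (symbolTokens R.funList R.varList)
          (symbolTokens R.funList R.varList) ρ.tokens τ.tokens := ⟨fun _ _ h h' => h h'.symm⟩
      exact h.forall hρ hτ hne
  rw [pairBlocks, localIsoFormula_blocks_iff, LocallyIsoKeeping, hnormal, hnormal]
  refine and_congr_right fun _ => and_congr_right fun hR' => ?_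
  rw [← hnormal] at hR'
  simp only [List.mem_map, forall_exists_index, and_imp, forall_apply_eq_imp_iff₂,
    exists_exists_and_eq_and, ← hiso R R', ← hiso R' R]
  constructor
  · rintro ⟨φ, hφ, himage⟩
    refine ⟨fun ρ hρ => ?_, fun τ hτ => ?_⟩
    · rw [R.mem_ruleList] at hρ
      have : (φ ⟨ρ, hρ⟩).mapRule ρ ∈ (R'.rules : Set (Rule R'.sig)) := by
        rw [← himage]
        exact ⟨⟨ρ, hρ⟩, rfl⟩
      exact ⟨_, (R'.mem_ruleList _).2 this, _, hφ _, rfl⟩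
    · rw [R'.mem_ruleList, ← Finset.mem_coe, ← himage] at hτ
      obtain ⟨ρ, rfl⟩ := hτ
      refine ⟨ρ, (R.mem_ruleList _).2 ρ.2, ?_⟩
      rw [hiso R' R]
      exact ((hiso R R' _ _).1 ⟨φ ρ, hφ ρ, rfl⟩).symm
  · rintro ⟨h, h'⟩
    choose τ hτ φ hφ hmap using h
    refine ⟨fun ρ => φ ρ ((R.mem_ruleList _).2 ρ.2), fun ρ => hφ _ _, ?_⟩
    ext σ
    constructor
    · rintro ⟨ρ, rfl⟩
      beta_reduce
      rw [hmap]
      exact (R'.mem_ruleList _).1 (hτ _ _)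
    · intro hσ
      obtain ⟨ρ, hρ, hiso'⟩ := h' σ ((R'.mem_ruleList _).2 hσ)
      refine ⟨⟨ρ, (R.mem_ruleList _).1 hρ⟩, ?_⟩
      beta_reduce
      rw [hmap]
      -- The image chosen for `ρ` and the rule `σ` are both isomorphic to `ρ`, hence to each other;
      -- the normal form of the second system forces them to be equal.
      by_contra hne
      refine hR' _ ((R'.mem_ruleList _).1 (hτ ρ hρ)) _ hσ hne ((hiso R' R' _ _).2 ?_)
      exact ((hiso R R' _ _).1 ⟨_, hφ ρ hρ, hmap ρ hρ⟩).symm.trans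
        ((hiso R' R _ _).1 hiso').symm

theorem DecidableInPolyTime.congr {α Γ : Type} {enc : α → List Γ} {P Q : α → Prop}
    (h : DecidableInPolyTime enc P) (hPQ : ∀ a, P a ↔ Q a) : DecidableInPolyTime enc Q := by
  rwa [← funext fun a => propext (hPQ a)]

/-- The formula about blocks is unfolded through both layers of codes, blocks as lists of tokens and
tokens as words, to a closed property `Q'` of words. -/
theorem decidableInPolyTime_locallyIsoKeeping : DecidableInPolyTime encodePair fun p =>
    LocallyIsoKeeping kf kv p.1.toTRS p.2.toTRS := by
  obtain ⟨Q, ⟨Q', hQ', hQ⟩, hP⟩ := BlockDec.localIsoFormula kf kv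
  refine (Dec.decidableInPolyTime (enc := encodePair) hQ').congr fun p => ?_
  rw [locallyIsoKeeping_iff, encodePair_eq]
  refine Iff.trans ?_ (hP (pairBlocks p) Fin.elim0 (fun i => i.elim0))
  rw [← hQ _ _ (fun i => i.elim0)]
  congr! 1

end TermRewriting

/-! ### The three local isomorphism problems -/

theorem theorem4p6 :
    TermRewriting.DecidableInPolyTime TermRewriting.encodePair
        (fun p => TermRewriting.LocallyIso p.1.toTRS p.2.toTRS) ∧
      TermRewriting.DecidableInPolyTime TermRewriting.encodePair
        (fun p => TermRewriting.VLocallyIso p.1.toTRS p.2.toTRS) ∧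
      TermRewriting.DecidableInPolyTime TermRewriting.encodePair
        (fun p => TermRewriting.FLocallyIso p.1.toTRS p.2.toTRS) := by
  open TermRewriting in
  -- The first flag keeps the names of function symbols, the second one those of variables.
  refine ⟨(TermRewriting.decidableInPolyTime_locallyIsoKeeping false false).congr fun p => ?_,
    (TermRewriting.decidableInPolyTime_locallyIsoKeeping true false).congr fun p => ?_,
    (TermRewriting.decidableInPolyTime_locallyIsoKeeping false true).congr fun p => ?_⟩
  · simp [LocallyIsoKeeping, LocallyIso, TRS.NormalFormKeeping, TRS.NormalForm, TermIso.Respects]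
  · simp [LocallyIsoKeeping, VLocallyIso, TRS.NormalFormKeeping, TRS.VNormalForm, TermIso.Respects]
  · simp [LocallyIsoKeeping, FLocallyIso, TRS.NormalFormKeeping, TRS.FNormalForm, TermIso.Respects]
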